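/- Let $n, d \ge 0$ be integers, $V = \mathbb{Q}^n$, and let $S(n,d) = \operatorname{End}_{\Sigma_d}(V^{\otimes d})$ be the Schur algebra over $\mathbb{Q}$, that is, the algebra of linear endomorphisms of $V^{\otimes d}$ commuting with the action of the symmetric group $\Sigma_d$ by permutation of the tensor places. Let $\varepsilon_1,\dots,\varepsilon_n$ be the standard basis of $\mathbb{Z}^n$, let $(\ ,\ )$ be the bilinear form with $(\varepsilon_i,\varepsilon_j)=\delta_{ij}$, and put $\alpha_j = \varepsilon_j - \varepsilon_{j+1}$. Then $S(n,d)$ is isomorphic to the associative $\mathbb{Q}$-algebra with $1$ on generators $e_i, f_i$ ($1\le i\le n-1$) and $H_i$ ($1\le i\le n$) subject to the relations \begin{align*} &\text{(R1)}\quad H_iH_j = H_jH_i;\\ &\text{(R2)}\quad e_if_j - f_je_i = \delta_{ij}(H_j - H_{j+1});\\ &\text{(R3)}\quad H_ie_j - e_jH_i = (\varepsilon_i,\alpha_j)\,e_j,\qquad H_if_j - f_jH_i = -(\varepsilon_i,\alpha_j)\,f_j;\\ &\text{(R4)}\quad e_i^2e_j - 2e_ie_je_i + e_je_i^2 = 0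 \ \ (|i-j|=1),\qquad e_ie_j - e_je_i = 0 \ \ (\text{otherwise});\\ &\text{(R5)}\quad f_i^2f_j - 2f_if_jf_i + f_jf_i^2 = 0 \ \ (|i-j|=1),\qquad f_if_j - f_jf_i = 0 \ \ (\text{otherwise});\\ &\text{(R6)}\quad H_1 + H_2 + \cdots + H_n = d;\\ &\text{(R7)}\quad H_k(H_k-1)\cdots(H_k-d) = 0 \qquad (k=1,\dots,n). \end{align*} More precisely, there is such an isomorphism that carries $e_i$, $f_i$, $H_k$ to the endomorphisms of $V^{\otimes d}$ given by the natural Lie algebra action $A \mapsto \sum_{p=1}^d 1^{\otimes (p-1)} \otimes A \otimes 1^{\otimes (d-p)}$ of the matrix units $E_{i,i+1}$, $E_{i+1,i}$, $E_{k,k} \in \mathfrak{gl}_n(\mathbb{Q})$, respectively. -/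

import Mathlib

namespace SchurPres

/-! ### The Schur algebra `S(n,d)` as a commutant on tensor space -/

/-- The tensor space `V^{⊗ d}` for `V = ℚⁿ`. -/
abbrev TensorSpace (n d : ℕ) : Type :=
  PiTensorProduct ℚ (fun _ : Fin d => Fin n → ℚ)

/-- The action of a permutation of the tensor places, `⊗ₚ v p ↦ ⊗ₚ v (σ⁻¹ p)`. -/
noncomputable def placePerm (n d : ℕ) (σ : Equiv.Perm (Fin d)) :
    Module.End ℚ (TensorSpace n d) :=
  (PiTensorProduct.reindex ℚ (fun _ : Fin d => Fin n → ℚ) σ).toLinearMap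

/-- `S(n,d) = End_{Σ_d}(V^{⊗ d})`: the endomorphisms of tensor space that commute with all
permutations of the tensor places. -/
noncomputable def schurAlgebra (n d : ℕ) : Subalgebra ℚ (Module.End ℚ (TensorSpace n d)) :=
  Subalgebra.centralizer ℚ (Set.range (placePerm n d))

/-- The Lie algebra action of a matrix `A ∈ 𝔤𝔩ₙ(ℚ)` on tensor space,
`∑ₚ 1 ⊗ ⋯ ⊗ A ⊗ ⋯ ⊗ 1` with `A` in place `p`. -/
noncomputable def tensorAction (n d : ℕ) (A : Matrix (Fin n) (Fin n) ℚ) :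
    Module.End ℚ (TensorSpace n d) :=
  ∑ p : Fin d, PiTensorProduct.map
    (fun q : Fin d => if q = p then Matrix.toLin' A else LinearMap.id)

/-! ### Indices and the root data of type `A_{n-1}`

A simple root is indexed by `i : Fin (n - 1)`; it involves the two coordinates `fst i` and
`snd i = fst i + 1`. -/

/-- The index `i`, for `1 ≤ i ≤ n - 1`, as an index in `{1, …, n}`. -/
def fst {n : ℕ} (i : Fin (n - 1)) : Fin n := ⟨i, by omega⟩

/-- The index `i + 1`, for `1 ≤ i ≤ n - 1`, as an index in `{1, …, n}`. -/
def snd {n : ℕ} (i : Fin (n - 1)) : Fin n := ⟨i + 1, by omega⟩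

/-- The standard basis vector `ε_i` of `ℤⁿ`. -/
def ε {n : ℕ} (i : Fin n) : Fin n → ℤ := Pi.single i 1

/-- The simple root `α_j = ε_j - ε_{j+1}`. -/
def α {n : ℕ} (j : Fin (n - 1)) : Fin n → ℤ := ε (fst j) - ε (snd j)

/-- `|i - j| = 1`. -/
def Adjacent {n : ℕ} (i j : Fin (n - 1)) : Prop := (i : ℕ) + 1 = j ∨ (j : ℕ) + 1 = i

/-! ### Generators and relations -/

/-- The symbols `e_i`, `f_i` (`1 ≤ i ≤ n - 1`) and `H_i` (`1 ≤ i ≤ n`). -/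
inductive Gen (n : ℕ) : Type
  | e (i : Fin (n - 1)) : Gen n
  | f (i : Fin (n - 1)) : Gen n
  | H (i : Fin n) : Gen n

/-- The free associative unital `ℚ`-algebra on the generators. -/
abbrev Free (n : ℕ) : Type := FreeAlgebra ℚ (Gen n)

namespace Free

/-- The free generator `e_i`. -/
noncomputable def e {n : ℕ} (i : Fin (n - 1)) : Free n := FreeAlgebra.ι ℚ (Gen.e i)

/-- The free generator `f_i`. -/
noncomputable def f {n : ℕ} (i : Fin (n - 1)) : Free n := FreeAlgebra.ι ℚ (Gen.f i)

/-- The free generator `H_i`. -/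
noncomputable def H {n : ℕ} (i : Fin n) : Free n := FreeAlgebra.ι ℚ (Gen.H i)

end Free

open Free in
/-- Serre's relations for the enveloping algebra `U(𝔤𝔩ₙ)`. -/
inductive SerreRel (n : ℕ) : Free n → Free n → Prop
  | H_comm (i j : Fin n) : SerreRel n (H i * H j) (H j * H i)
  | e_f (i j : Fin (n - 1)) :
      SerreRel n (e i * f j - f j * e i) (if i = j then H (fst j) - H (snd j) else 0)
  | H_e (i : Fin n) (j : Fin (n - 1)) :
      SerreRel n (H i * e j - e j * H i) ((ε i ⬝ᵥ α j) • e j)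
  | H_f (i : Fin n) (j : Fin (n - 1)) :
      SerreRel n (H i * f j - f j * H i) (-((ε i ⬝ᵥ α j) • f j))
  | e_serre (i j : Fin (n - 1)) (h : Adjacent i j) :
      SerreRel n (e i ^ 2 * e j - 2 * e i * e j * e i + e j * e i ^ 2) 0
  | e_comm (i j : Fin (n - 1)) (h : ¬ Adjacent i j) :
      SerreRel n (e i * e j - e j * e i) 0
  | f_serre (i j : Fin (n - 1)) (h : Adjacent i j) :
      SerreRel n (f i ^ 2 * f j - 2 * f i * f j * f i + f j * f i ^ 2) 0
  | f_comm (i j : Fin (n - 1)) (h : ¬ Adjacent i j) :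
      SerreRel n (f i * f j - f j * f i) 0

open Free in
/-- The defining relations of the presented algebra: Serre's relations together with
`H_1 + ⋯ + H_n = d` and `H_k (H_k - 1) ⋯ (H_k - d) = 0` for every `k`. -/
inductive SchurRel (n d : ℕ) : Free n → Free n → Prop
  | serre {x y : Free n} (h : SerreRel n x y) : SchurRel n d x y
  | H_sum : SchurRel n d (∑ i : Fin n, H i) (d : Free n)
  | H_prod (k : Fin n) :
      SchurRel n d ((List.range (d + 1)).map (fun m => H k - (m : Free n))).prod 0

/-- The associative unital `ℚ`-algebra on generators `e_i`, `f_i`, `H_i` subject to the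
relations `SchurRel n d`. -/
abbrev PresentedAlgebra (n d : ℕ) : Type := RingQuot (SchurRel n d)

/-- The class of a generator in the presented algebra. -/
noncomputable def gen (n d : ℕ) (g : Gen n) : PresentedAlgebra n d :=
  RingQuot.mkAlgHom ℚ (SchurRel n d) (FreeAlgebra.ι ℚ g)

end SchurPres

/-! Let `T` be the presented algebra. Matrix units acting on tensor space satisfy the relations, so
there is a homomorphism from `T` to the endomorphisms of tensor space, with image exactly the Schur
algebra `S` (`range_tensorHom`). It is an isomorphism because both dimensions are squeezed: `dim T ≤
N ≤ dim S ≤ dim T`, where `N` is the number of multisets of size `d` on `n ^ 2` letters.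

The substance is the bound `dim T ≤ N`. Let `C` be the span of the `H_k` in `T`, and `L` the span of
`C` and the iterated brackets of the `e_i` and of the `f_i`. Serre's relations make `L` closed under
commutators (`IsSerre.lie_mem`), so the powers of `1 + L` form a filtration in which reordering a
product costs only lower degree. The claim is `(1 + L)^d = T` (`one_sup_genSpan_pow`).

For Cartan elements the reason is that a joint eigenvalue of the `H_k` consists of natural numbers
with sum `d`. Hence a product of falling factorials of the `H_k` of total degree `d + 1` vanishes
(`descList_eq_zero`), and its leading monomial has lower degree: `C^(d+1) ≤ (1 + L)^d`. To pass from
`C` to `L`, a root vector `y` with `[y, h] = y` for some `h` in `C` satisfies `y c ≡ [y, z]` modulo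
lower degree, with `z` in `C` of degree one more than `c`. So root vectors can be traded one at a
time for Cartan factors (`pow_mul_pow_le_of_weights`), and `L^(d+1) ≤ (1 + L)^d`.

Since `H_1 + ⋯ + H_n = d`, the space `1 + L` is spanned by `n ^ 2` elements, one of them `1`. Sorted
products of `d` of these span `T`, and there are `N` of them.

For `S`, averaging over `Σ_d` and symmetrised pure tensors show that the operators `∑ 1 ⊗ ⋯ ⊗ X ⊗ ⋯
⊗ 1` generate it (`schurAlgebra_le`); functions on the orbits of pairs of multi-indices embed in it,
whence `N ≤ dim S`. -/

namespace SchurPres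

/-! ### Root vectors in Lie algebras with Serre generators -/

section RootVectors

variable {L : Type*} [LieRing L] [LieAlgebra ℚ L]

/-- The coordinate at `l` of `ε_i - ε_j`. -/
def wt (l i j : ℕ) : ℚ := (if l = i then 1 else 0) - (if l = j then 1 else 0)

/-- Serre's relations in a Lie algebra, for families indexed by `ℕ` of which only the `e i`, `f i`
with `i < m` are nonzero. -/
structure IsSerre (m : ℕ) (e f H : ℕ → L) : Prop where
  HH (i j : ℕ) : ⁅H i, H j⁆ = 0
  ef (i j : ℕ) (h : i ≠ j) : ⁅e i, f j⁆ = 0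
  ef_self (i : ℕ) (h : i < m) : ⁅e i, f i⁆ = H i - H (i + 1)
  He (l j : ℕ) : ⁅H l, e j⁆ = wt l j (j + 1) • e j
  Hf (l j : ℕ) : ⁅H l, f j⁆ = -(wt l j (j + 1) • f j)
  e_serre (i j : ℕ) (h : i + 1 = j ∨ j + 1 = i) : ⁅e i, ⁅e i, e j⁆⁆ = 0
  e_comm (i j : ℕ) (h : ¬ (i + 1 = j ∨ j + 1 = i)) : ⁅e i, e j⁆ = 0
  f_serre (i j : ℕ) (h : i + 1 = j ∨ j + 1 = i) : ⁅f i, ⁅f i, f j⁆⁆ = 0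
  f_comm (i j : ℕ) (h : ¬ (i + 1 = j ∨ j + 1 = i)) : ⁅f i, f j⁆ = 0
  e_zero (i : ℕ) (h : m ≤ i) : e i = 0
  f_zero (i : ℕ) (h : m ≤ i) : f i = 0

/-- The iterated bracket `[…[e i, e (i+1)], …, e (i+k)]`, a root vector for
`ε_i - ε_{i+k+1}`. -/
def rootVec (e : ℕ → L) (i : ℕ) : ℕ → L
  | 0 => e i
  | k + 1 => ⁅rootVec e i k, e (i + k + 1)⁆

/-- The Chevalley involution. -/
lemma IsSerre.symm {m : ℕ} {e f H : ℕ → L} (h : IsSerre m e f H) :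
    IsSerre m f e (fun i => -H i) where
  HH i j := by simp [h.HH]
  ef i j hij := by rw [← lie_skew, h.ef j i hij.symm, neg_zero]
  ef_self i hi := by rw [← lie_skew, h.ef_self i hi]; abel
  He l j := by rw [neg_lie, h.Hf, neg_neg]
  Hf l j := by rw [neg_lie, h.He]
  e_serre := h.f_serre
  e_comm := h.f_comm
  f_serre := h.e_serre
  f_comm := h.e_comm
  e_zero := h.f_zero
  f_zero := h.e_zero

-- The derivation `ad b` kills `R`, so `(ad b)²` sends `⁅R, a⁆` to `⁅R, (ad b)² a⁆ = 0`.
omit [LieAlgebra ℚ L] in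
lemma lie_lie_eq_zero_of_comm {b R a : L} (h1 : ⁅b, R⁆ = 0) (h2 : ⁅b, ⁅b, a⁆⁆ = 0) :
    ⁅b, ⁅⁅R, a⁆, b⁆⁆ = 0 := by
  have h3 : ⁅b, ⁅R, a⁆⁆ = ⁅R, ⁅b, a⁆⁆ := by rw [leibniz_lie, h1, zero_lie, zero_add]
  have h4 : ⁅b, ⁅b, ⁅R, a⁆⁆⁆ = 0 := by rw [h3, leibniz_lie, h1, h2]; simp
  rw [← lie_skew ⁅R, a⁆ b, lie_neg, h4, neg_zero]

/-- Expanding the element through `⁅a, b⁆`, which `ad b` kills, gives `⁅⁅a, b⁆, ⁅b, c⁆⁆`. Expanding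
it through `⁅b, c⁆`, after rewriting `⁅⁅a, b⁆, c⁆ = ⁅a, ⁅b, c⁆⁆`, gives the negative of that. Hence
twice the element is zero. -/
lemma lie_lie_eq_zero_of_serre {a b c : L} (h1 : ⁅a, c⁆ = 0) (h2 : ⁅b, ⁅b, a⁆⁆ = 0)
    (h3 : ⁅b, ⁅b, c⁆⁆ = 0) : ⁅b, ⁅⁅a, b⁆, c⁆⁆ = 0 := by
  have h4 : ⁅b, ⁅a, b⁆⁆ = 0 := by rw [← lie_skew a b, lie_neg, h2, neg_zero]
  have h5 : ⁅b, ⁅⁅a, b⁆, c⁆⁆ = ⁅⁅a, b⁆, ⁅b, c⁆⁆ := by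
    rw [leibniz_lie, h4, zero_lie, zero_add]
  have h6 : ⁅⁅a, b⁆, c⁆ = ⁅a, ⁅b, c⁆⁆ := by
    rw [lie_lie, h1, lie_zero, sub_zero]
  have h7 : ⁅b, ⁅⁅a, b⁆, c⁆⁆ = -⁅⁅a, b⁆, ⁅b, c⁆⁆ := by
    rw [h6, leibniz_lie, h3, lie_zero, add_zero, ← lie_skew a b, neg_lie, neg_neg]
  have h8 : (2 : ℚ) • ⁅b, ⁅⁅a, b⁆, c⁆⁆ = 0 := by
    rw [two_smul]; nth_rw 1 [h5]; rw [h7]; simp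
  simpa using h8

/-! ### Brackets of simple root vectors with root vectors. -/

variable {m : ℕ} {e f H : ℕ → L} (h : IsSerre m e f H)
include h

lemma IsSerre.lie_rootVec_far (i k j : ℕ) (hj : j + 1 < i ∨ i + k + 1 < j) :
    ⁅e j, rootVec e i k⁆ = 0 := by
  induction k with
  | zero => exact h.e_comm _ _ (by omega)
  | succ k ih =>
    rw [rootVec, leibniz_lie, ih (by omega), h.e_comm j (i + k + 1) (by omega)]; simp

lemma IsSerre.lie_rootVec_succ (i k : ℕ) : ⁅e i, rootVec e (i + 1) k⁆ = rootVec e i (k + 1) := by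
  induction k with
  | zero => rfl
  | succ k ih =>
    rw [rootVec, leibniz_lie, ih, h.e_comm i (i + 1 + k + 1) (by omega), lie_zero, add_zero]
    rw [rootVec.eq_2 e i (k + 1), show i + 1 + k + 1 = i + (k + 1) + 1 by ring]

/-- In terms of roots: adding `α_j` to `ε_i - ε_{i+k+1}` gives no root. -/
lemma IsSerre.lie_rootVec_inner (i k j : ℕ) (h1 : i ≤ j) (h2 : j ≤ i + k) :
    ⁅e j, rootVec e i k⁆ = 0 := by
  induction k generalizing j with
  | zero => obtain rfl : j = i := by omega
            simp [rootVec]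
  | succ k ih =>
    -- If `j` is neither of the last two letters, `e j` commutes with both sides of the outer
    -- bracket. The last two letters reduce to a Serre relation for short brackets, and to the two
    -- Lie identities above otherwise.
    rcases lt_trichotomy j (i + k) with hj | hj | hj
    · rw [rootVec, leibniz_lie, ih j h1 hj.le, h.e_comm j (i + k + 1) (by omega)]; simp
    · rcases k with _ | k
      · subst hj
        exact h.e_serre _ _ (Or.inl rfl)
      · have hA := ih j h1 hj.le
        rw [rootVec.eq_2] at hA
        rw [rootVec, rootVec]
        subst hj
        rw [← add_assoc] at hA ⊢
        refine lie_lie_eq_zero_of_serre ?_ ?_ (h.e_serre _ _ (by omega))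
        · rw [← lie_skew, h.lie_rootVec_far _ _ _ (by omega), neg_zero]
        · rw [← lie_skew (e _) (rootVec e i k), lie_neg, hA, neg_zero]
    · obtain rfl : j = i + k + 1 := by omega
      rcases k with _ | k
      · rw [rootVec, rootVec, ← lie_skew (e i) (e _), lie_neg, h.e_serre _ _ (by omega), neg_zero]
      · rw [rootVec, rootVec]
        exact lie_lie_eq_zero_of_comm (h.lie_rootVec_far _ _ _ (by omega))
          (h.e_serre _ _ (by omega))

lemma IsSerre.lie_H_rootVec (l i k : ℕ) :
    ⁅H l, rootVec e i k⁆ = wt l i (i + k + 1) • rootVec e i k := by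
  induction k with
  | zero => exact h.He l i
  | succ k ih =>
    rw [rootVec, leibniz_lie, ih, h.He, smul_lie, lie_smul, ← add_smul]
    congr 1
    simp only [wt]
    ring_nf

lemma IsSerre.lie_H_rootVec_neg (l i k : ℕ) :
    ⁅H l, rootVec f i k⁆ = (-wt l i (i + k + 1)) • rootVec f i k := by
  rw [neg_smul, ← h.symm.lie_H_rootVec, neg_lie, neg_neg]

/-- Provides the Cartan element `h` with `⁅y, h⁆ = y` on which the trading of root vectors for
Cartan factors rests. -/
lemma IsSerre.rootVec_lie_neg_H (i k : ℕ) : ⁅rootVec e i k, -H i⁆ = rootVec e i k := by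
  rw [lie_neg, lie_skew, h.lie_H_rootVec, wt, if_pos rfl, if_neg (by omega), sub_zero, one_smul]

lemma IsSerre.rootVec_neg_lie_H (i k : ℕ) : ⁅rootVec f i k, H i⁆ = rootVec f i k := by
  simpa using h.symm.rootVec_lie_neg_H i k

omit h in
lemma exists_lie_eq_smul {ι : Type*} {c : ι → L} {y : L} {w : ι → ℚ} (hy : ∀ l, ⁅c l, y⁆ = w l • y) :
    ∀ x ∈ Submodule.span ℚ (Set.range c), ∃ r : ℚ, ⁅y, x⁆ = r • y := by
  intro x hx
  refine Submodule.span_induction (p := fun x _ => ∃ r : ℚ, ⁅y, x⁆ = r • y) ?_ ?_ ?_ ?_ hx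
  · rintro _ ⟨k, rfl⟩
    exact ⟨-w k, by rw [← lie_skew, hy, neg_smul]⟩
  · exact ⟨0, by simp⟩
  · rintro x z _ _ ⟨r, hr⟩ ⟨s, hs⟩
    exact ⟨r + s, by rw [lie_add, hr, hs, add_smul]⟩
  · rintro a x _ ⟨r, hr⟩
    exact ⟨a * r, by rw [lie_smul, hr, smul_smul]⟩

lemma IsSerre.lie_f_rootVec_outer (i k j : ℕ) (hj : j < i ∨ i + k < j) :
    ⁅f j, rootVec e i k⁆ = 0 := by
  induction k with
  | zero => rw [rootVec, ← lie_skew, h.ef _ _ (by omega), neg_zero]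
  | succ k ih =>
    rw [rootVec, leibniz_lie, ih (by omega), ← lie_skew (f j), h.ef _ _ (by omega)]; simp

/-- Only the last letter contributes, through `H (i+k+1) - H (i+k+2)`, and the remaining root vector
has weight `-1` for this difference. -/
lemma IsSerre.lie_f_rootVec_last (i k : ℕ) (hm : i + k + 1 < m) :
    ⁅f (i + k + 1), rootVec e i (k + 1)⁆ = -rootVec e i k := by
  rw [rootVec, leibniz_lie, h.lie_f_rootVec_outer _ _ _ (by omega), zero_lie, zero_add,
    ← lie_skew (f _), h.ef_self _ hm, lie_neg, lie_skew, sub_lie, h.lie_H_rootVec,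
    h.lie_H_rootVec, ← sub_smul, ← neg_one_smul ℚ]
  congr 1
  simp only [wt]
  simp [show i + k + 1 ≠ i by omega, show i + k + 1 + 1 ≠ i by omega]

lemma IsSerre.lie_f_rootVec_first (i k : ℕ) (hm : i < m) :
    ⁅f i, rootVec e i (k + 1)⁆ = rootVec e (i + 1) k := by
  rw [← h.lie_rootVec_succ, leibniz_lie, h.lie_f_rootVec_outer _ _ _ (by omega), lie_zero,
    add_zero, ← lie_skew (f _), h.ef_self _ hm, neg_lie, sub_lie, h.lie_H_rootVec,
    h.lie_H_rootVec, ← sub_smul, ← neg_smul]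
  conv_rhs => rw [← one_smul ℚ (rootVec e (i + 1) k)]
  congr 1
  simp only [wt]
  simp [show ¬ i = i + 1 + k by omega, show ¬ i = i + 1 + k + 1 by omega]

lemma IsSerre.lie_f_rootVec_inner (i k j : ℕ) (h1 : i < j) (h2 : j < i + k) :
    ⁅f j, rootVec e i k⁆ = 0 := by
  induction k with
  | zero => omega
  | succ k ih =>
    rw [rootVec, leibniz_lie, ← lie_skew (f j) (e _), h.ef _ _ (by omega), neg_zero, lie_zero,
      add_zero]
    rcases lt_or_ge j (i + k) with hj | hj
    · rw [ih hj, zero_lie]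
    -- Here `j` is the penultimate letter. Removing it leaves a shorter root vector, no longer
    -- adjacent to the final letter, so the two commute.
    · obtain ⟨k, rfl⟩ : ∃ k', k = k' + 1 := ⟨k - 1, by omega⟩
      obtain rfl : j = i + k + 1 := by omega
      rcases lt_or_ge (i + k + 1) m with hm | hm
      · rw [h.lie_f_rootVec_last _ _ hm, neg_lie, lie_skew]
        exact h.lie_rootVec_far _ _ _ (by omega)
      · rw [h.f_zero _ hm]; simp

/-! ### Closure of the span of root vectors and Cartan elements under the bracket. -/

omit h in
/-- The span of the root vectors and the Cartan elements. -/
def rootSpan (e f H : ℕ → L) : Submodule ℚ L :=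
  Submodule.span ℚ ({x | ∃ i k, x = rootVec e i k} ∪ {x | ∃ i k, x = rootVec f i k} ∪
    {x | ∃ i, x = H i})

omit h in
lemma rootVec_mem (e f H : ℕ → L) (i k : ℕ) : rootVec e i k ∈ rootSpan e f H :=
  Submodule.subset_span (Or.inl (Or.inl ⟨i, k, rfl⟩))

omit h in
lemma rootVec_mem' (e f H : ℕ → L) (i k : ℕ) : rootVec f i k ∈ rootSpan e f H :=
  Submodule.subset_span (Or.inl (Or.inr ⟨i, k, rfl⟩))

omit h in
lemma H_mem (e f H : ℕ → L) (i : ℕ) : H i ∈ rootSpan e f H :=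
  Submodule.subset_span (Or.inr ⟨i, rfl⟩)

omit h in
lemma rootSpan_symm (e f H : ℕ → L) : rootSpan f e (fun i => -H i) = rootSpan e f H := by
  apply le_antisymm <;> refine Submodule.span_le.2 ?_ <;>
    rintro x ((⟨i, k, rfl⟩ | ⟨i, k, rfl⟩) | ⟨i, rfl⟩)
  · exact rootVec_mem' _ _ _ _ _
  · exact rootVec_mem _ _ _ _ _
  · exact neg_mem (H_mem _ _ _ _)
  · exact rootVec_mem' _ _ _ _ _
  · exact rootVec_mem _ _ _ _ _
  · simpa using neg_mem (H_mem f e (fun i => -H i) i)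

lemma IsSerre.lie_e_rootVec_mem (i k j : ℕ) : ⁅e j, rootVec e i k⁆ ∈ rootSpan e f H := by
  by_cases h1 : j + 1 < i ∨ i + k + 1 < j
  · rw [h.lie_rootVec_far _ _ _ h1]; exact zero_mem _
  by_cases h2 : j + 1 = i
  · subst h2; rw [h.lie_rootVec_succ]; exact rootVec_mem _ _ _ _ _
  by_cases h3 : j = i + k + 1
  · subst h3; rw [← lie_skew]; exact neg_mem (rootVec_mem e f H i (k + 1))
  · rw [h.lie_rootVec_inner _ _ _ (by omega) (by omega)]; exact zero_mem _

lemma IsSerre.lie_f_rootVec_mem (i k j : ℕ) : ⁅f j, rootVec e i k⁆ ∈ rootSpan e f H := by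
  by_cases h0 : m ≤ j
  · rw [h.f_zero _ h0, zero_lie]; exact zero_mem _
  by_cases h1 : j < i ∨ i + k < j
  · rw [h.lie_f_rootVec_outer _ _ _ h1]; exact zero_mem _
  rcases k with _ | k
  · obtain rfl : j = i := by omega
    rw [rootVec, ← lie_skew, h.ef_self _ (by omega)]
    exact neg_mem (sub_mem (H_mem _ _ _ _) (H_mem _ _ _ _))
  by_cases h2 : j = i
  · subst h2; rw [h.lie_f_rootVec_first _ _ (by omega)]; exact rootVec_mem _ _ _ _ _
  by_cases h3 : j = i + k + 1
  · subst h3; rw [h.lie_f_rootVec_last _ _ (by omega)]; exact neg_mem (rootVec_mem _ _ _ _ _)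
  · rw [h.lie_f_rootVec_inner _ _ _ (by omega) (by omega)]; exact zero_mem _

omit h in
lemma lie_mem_of_generators {e f H : ℕ → L} {x : L}
    (h1 : ∀ i k, ⁅x, rootVec e i k⁆ ∈ rootSpan e f H)
    (h2 : ∀ i k, ⁅x, rootVec f i k⁆ ∈ rootSpan e f H) (h3 : ∀ i, ⁅x, H i⁆ ∈ rootSpan e f H) :
    ∀ y ∈ rootSpan e f H, ⁅x, y⁆ ∈ rootSpan e f H := by
  intro y hy
  refine Submodule.span_induction (p := fun y _ => ⁅x, y⁆ ∈ rootSpan e f H) ?_ (by simp) ?_ ?_ hy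
  · rintro x ((⟨i, k, rfl⟩ | ⟨i, k, rfl⟩) | ⟨i, rfl⟩)
    exacts [h1 i k, h2 i k, h3 i]
  · intro y z _ _ hy hz; rw [lie_add]; exact add_mem hy hz
  · intro a y _ hy; rw [lie_smul]; exact Submodule.smul_mem _ _ hy

lemma IsSerre.lie_e_mem (j : ℕ) : ∀ y ∈ rootSpan e f H, ⁅e j, y⁆ ∈ rootSpan e f H := by
  refine lie_mem_of_generators (fun i k => h.lie_e_rootVec_mem i k j) (fun i k => ?_) fun i => ?_
  · rw [← rootSpan_symm]; exact h.symm.lie_f_rootVec_mem i k j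
  · rw [← lie_skew, h.He]
    exact neg_mem (Submodule.smul_mem _ _ (rootVec_mem e f H j 0))

lemma IsSerre.lie_f_mem (j : ℕ) : ∀ y ∈ rootSpan e f H, ⁅f j, y⁆ ∈ rootSpan e f H := by
  rw [← rootSpan_symm]; exact h.symm.lie_e_mem j

lemma IsSerre.lie_H_mem (j : ℕ) : ∀ y ∈ rootSpan e f H, ⁅H j, y⁆ ∈ rootSpan e f H := by
  refine lie_mem_of_generators (fun i k => ?_) (fun i k => ?_) fun i => ?_
  · rw [h.lie_H_rootVec]; exact Submodule.smul_mem _ _ (rootVec_mem _ _ _ _ _)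
  · have := h.symm.lie_H_rootVec j i k
    rw [neg_lie, neg_eq_iff_eq_neg] at this
    rw [this]; exact neg_mem (Submodule.smul_mem _ _ (rootVec_mem' _ _ _ _ _))
  · rw [h.HH]; exact zero_mem _

omit h in
lemma lie_rootVec_mem_of {e' : ℕ → L} {M : Submodule ℚ L}
    (he : ∀ j, ∀ y ∈ M, ⁅e' j, y⁆ ∈ M) (i k : ℕ) : ∀ y ∈ M, ⁅rootVec e' i k, y⁆ ∈ M := by
  induction k with
  | zero => exact he i
  | succ k ih =>
    intro y hy
    rw [rootVec, lie_lie]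
    exact sub_mem (ih _ (he _ _ hy)) (he _ _ (ih _ hy))

/-- The span of the root vectors and the Cartan elements is closed under the bracket. -/
lemma IsSerre.lie_mem {x y : L} (hx : x ∈ rootSpan e f H) (hy : y ∈ rootSpan e f H) :
    ⁅x, y⁆ ∈ rootSpan e f H := by
  rw [← lie_skew]
  refine neg_mem (lie_mem_of_generators (fun i k => ?_) (fun i k => ?_) (fun i => ?_) x hx) <;>
    rw [← lie_skew] <;> refine neg_mem ?_
  · exact lie_rootVec_mem_of h.lie_e_mem i k y hy
  · exact lie_rootVec_mem_of h.lie_f_mem i k y hy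
  · exact h.lie_H_mem i y hy

end RootVectors

/-! ### Powers of a subspace closed under commutators -/

section AssociativeLie

attribute [local instance 100] LieRing.ofAssociativeRing

section Filtration

variable {A : Type*} [Ring A] [Algebra ℚ A]

/-- `S ^ (m - 1)`, read as `⊥` for `m = 0`. -/
def lowerPow (S : Submodule ℚ A) : ℕ → Submodule ℚ A
  | 0 => ⊥
  | m + 1 => S ^ m

lemma pow_mul_lowerPow_le (S : Submodule ℚ A) (a b : ℕ) :
    S ^ a * lowerPow S b ≤ lowerPow S (a + b) := by
  rcases b with _ | b
  · simp [lowerPow]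
  · simp [lowerPow, pow_add]

lemma lie_pow_mem {x : A} {M : Submodule ℚ A} (h : ∀ y ∈ M, ⁅x, y⁆ ∈ M) (k : ℕ) :
    ∀ u ∈ M ^ k, ⁅x, u⁆ ∈ M ^ k := by
  intro u hu
  induction hu using Submodule.pow_induction_on_left' with
  | algebraMap r =>
    rw [Ring.lie_def, Algebra.commutes r x, sub_self]; exact zero_mem _
  | add u v i hu hv hu' hv' => rw [lie_add]; exact add_mem hu' hv'
  | mem_mul y hy i u hu hu' =>
    have : ⁅x, y * u⁆ = ⁅x, y⁆ * u + y * ⁅x, u⁆ := by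
      simp only [Ring.lie_def]; noncomm_ring
    rw [this, pow_succ']
    exact add_mem (Submodule.mul_mem_mul (h y hy) hu) (Submodule.mul_mem_mul hy hu')

/-! ### Trading root vectors for Cartan factors modulo lower degree. -/

variable {L C : Submodule ℚ A}

lemma lie_algebraMap (x : A) (r : ℚ) : ⁅x, algebraMap ℚ A r⁆ = 0 := by
  rw [Ring.lie_def, Algebra.commutes r x, sub_self]

lemma lie_one_sup_mem (hL : ∀ x ∈ L, ∀ y ∈ L, ⁅x, y⁆ ∈ L) {x : A} (hx : x ∈ L) :
    ∀ y ∈ 1 ⊔ L, ⁅x, y⁆ ∈ 1 ⊔ L := by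
  intro y hy
  obtain ⟨a, ha, z, hz, rfl⟩ := Submodule.mem_sup.1 hy
  obtain ⟨r, rfl⟩ := Submodule.mem_one.1 ha
  rw [lie_add, lie_algebraMap, zero_add]
  exact Submodule.mem_sup_right (hL x hx z hz)

lemma lie_mem_one_sup (hL : ∀ x ∈ L, ∀ y ∈ L, ⁅x, y⁆ ∈ L) {x y : A} (hx : x ∈ 1 ⊔ L)
    (hy : y ∈ 1 ⊔ L) : ⁅x, y⁆ ∈ 1 ⊔ L := by
  obtain ⟨a, ha, z, hz, rfl⟩ := Submodule.mem_sup.1 hx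
  obtain ⟨r, rfl⟩ := Submodule.mem_one.1 ha
  rw [add_lie, ← lie_skew, lie_algebraMap, neg_zero, zero_add]
  exact lie_one_sup_mem hL hz y hy

lemma one_le_one_sup : (1 : Submodule ℚ A) ≤ 1 ⊔ L := le_sup_left

lemma one_sup_pow_mono {a b : ℕ} (h : a ≤ b) : (1 ⊔ L) ^ a ≤ (1 ⊔ L) ^ b :=
  pow_le_pow_right₀ one_le_one_sup h

lemma pow_le_one_sup_pow (hCL : C ≤ L) (k : ℕ) : C ^ k ≤ (1 ⊔ L) ^ k :=
  pow_le_pow_left' (hCL.trans le_sup_right) k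

/-- Each of the `a + 1` factors `h` contributes one `y`; moving these to the left changes the sum
only in degree at most `a`. -/
lemma lie_pow_sub_mem (hL : ∀ x ∈ L, ∀ y ∈ L, ⁅x, y⁆ ∈ L) {y h : A} (hy : y ∈ L) (hh : h ∈ L)
    (hyh : ⁅y, h⁆ = y) (a : ℕ) :
    ⁅y, h ^ (a + 1)⁆ - ((a : ℚ) + 1) • (y * h ^ a) ∈ (1 ⊔ L) ^ a := by
  induction a with
  | zero => simp [hyh]
  | succ a ih =>
    have e1 : ⁅y, h ^ (a + 1 + 1)⁆ - (((a + 1 : ℕ) : ℚ) + 1) • (y * h ^ (a + 1)) =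
        (⁅y, h ^ (a + 1)⁆ - ((a : ℚ) + 1) • (y * h ^ a)) * h - ⁅y, h ^ (a + 1)⁆ := by
      have : ⁅y, h ^ (a + 1 + 1)⁆ = ⁅y, h ^ (a + 1)⁆ * h + h ^ (a + 1) * ⁅y, h⁆ := by
        simp only [Ring.lie_def, pow_succ]; noncomm_ring
      rw [this, hyh, sub_mul, smul_mul_assoc, mul_assoc y, ← pow_succ, add_smul]
      push_cast
      have h2 : h ^ (a + 1) * y = y * h ^ (a + 1) - ⁅y, h ^ (a + 1)⁆ := by
        rw [Ring.lie_def]; abel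
      rw [one_smul, h2]
      abel
    rw [e1]
    refine sub_mem ?_ (lie_pow_mem (lie_one_sup_mem hL hy) _ _
      (Submodule.pow_mem_pow _ (Submodule.mem_sup_right hh) _))
    rw [pow_succ]
    exact Submodule.mul_mem_mul ih (Submodule.mem_sup_right hh)

/-- Every product `y c` with `c` of degree `t + a` in a commutative `C` is, up to terms of lower
degree, a commutator with `y`. -/
lemma exists_lie_sub_mem (hL : ∀ x ∈ L, ∀ y ∈ L, ⁅x, y⁆ ∈ L) (hCL : C ≤ L)
    (hC : ∀ x ∈ C, ∀ y ∈ C, x * y = y * x) {y h : A} (hy : y ∈ L) (hh : h ∈ C)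
    (hyh : ⁅y, h⁆ = y) (hyC : ∀ c ∈ C, ∃ r : ℚ, ⁅y, c⁆ = r • y) {t : ℕ} {c : A}
    (hc : c ∈ C ^ t) :
    ∀ a : ℕ, ∃ z ∈ C ^ (t + a + 1), ⁅y, z⁆ - y * (h ^ a * c) ∈ (1 ⊔ L) ^ (t + a) := by
  induction hc using Submodule.pow_induction_on_left' with
  | algebraMap r =>
    intro a
    -- The antiderivative of `r • h ^ a`: modulo lower degree, `⁅y, ·⁆` acts on powers of `h` as `y`
    -- times differentiation.
    refine ⟨(r / (a + 1)) • h ^ (a + 1), Submodule.smul_mem _ _ ?_, ?_⟩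
    · rw [zero_add]; exact Submodule.pow_mem_pow _ hh _
    · have := Submodule.smul_mem _ (r / (a + 1)) (lie_pow_sub_mem hL hy (hCL hh) hyh a)
      rw [smul_sub, smul_smul, div_mul_cancel₀ _ (by positivity)] at this
      rwa [zero_add, lie_smul, ← Algebra.commutes, ← Algebra.smul_def, mul_smul_comm]
  | add c c' i hc hc' ih ih' =>
    intro a
    obtain ⟨z, hz, hz'⟩ := ih a
    obtain ⟨w, hw, hw'⟩ := ih' a
    refine ⟨z + w, add_mem hz hw, ?_⟩
    rw [lie_add, mul_add, mul_add, add_sub_add_comm]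
    exact add_mem hz' hw'
  | mem_mul g hg i c hc ih =>
    intro a
    obtain ⟨r, hr⟩ := hyC g hg
    obtain ⟨z, hz, hz'⟩ := ih (a + 1)
    obtain ⟨w, hw, hw'⟩ := ih a
    -- Split `g` into `r • h` and a part commuting with `y`. The first raises the power of `h`,
    -- which is why the induction keeps `a` arbitrary; the second passes through the commutator.
    set g' := g - r • h with hg'
    have hgC : g' ∈ C := sub_mem hg (Submodule.smul_mem _ _ hh)
    have hyg : ⁅y, g'⁆ = 0 := by rw [hg', lie_sub, lie_smul, hr, hyh, sub_self]
    have hcomm : ∀ a : ℕ, g' * h ^ a = h ^ a * g' := fun a =>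
      (Commute.pow_right (hC _ hgC _ hh : Commute g' h) a)
    refine ⟨r • z + g' * w, add_mem (Submodule.smul_mem _ _ ?_) ?_, ?_⟩
    · rwa [show i.succ + a + 1 = i + (a + 1) + 1 by rw [Nat.succ_eq_add_one]; ring]
    · rw [show i.succ + a + 1 = (i + a + 1) + 1 by rw [Nat.succ_eq_add_one]; ring, pow_succ']
      exact Submodule.mul_mem_mul hgC hw
    · have e1 : ⁅y, r • z + g' * w⁆ - y * (h ^ a * (g * c)) =
          r • (⁅y, z⁆ - y * (h ^ (a + 1) * c)) + g' * (⁅y, w⁆ - y * (h ^ a * c)) := by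
        have h1 : ⁅y, g' * w⁆ = g' * ⁅y, w⁆ := by
          have : ⁅y, g' * w⁆ = ⁅y, g'⁆ * w + g' * ⁅y, w⁆ := by
            simp only [Ring.lie_def]; noncomm_ring
          rw [this, hyg, zero_mul, zero_add]
        have h2 : g' * (y * (h ^ a * c)) = y * (h ^ a * (g' * c)) := by
          rw [Ring.lie_def, sub_eq_zero] at hyg
          rw [← mul_assoc, ← hyg, mul_assoc, ← mul_assoc g', hcomm, mul_assoc]
        have h3 : g = g' + r • h := by rw [hg']; abel
        rw [lie_add, lie_smul, h1, mul_sub, h2, h3, smul_sub, add_mul, mul_add, mul_add,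
          smul_mul_assoc, mul_smul_comm, mul_smul_comm, pow_succ, mul_assoc (h ^ a)]
        abel
      rw [e1]
      refine add_mem (Submodule.smul_mem _ _ ?_) ?_
      · rwa [show i.succ + a = i + (a + 1) by rw [Nat.succ_eq_add_one]; ring]
      · rw [show i.succ + a = (i + a) + 1 by rw [Nat.succ_eq_add_one]; ring, pow_succ']
        exact Submodule.mul_mem_mul (Submodule.mem_sup_right (hCL hgC)) hw'

/-- Induction on the number `r` of factors from `L`: the last one is either in `C` already or is a
`y` in `Y`, and in both cases is exchanged for one more factor from `C`. -/
lemma pow_mul_pow_le_of_weights (hL : ∀ x ∈ L, ∀ y ∈ L, ⁅x, y⁆ ∈ L) (hCL : C ≤ L)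
    (hC : ∀ x ∈ C, ∀ y ∈ C, x * y = y * x) {Y : Set A}
    (hY : ∀ y ∈ Y, (∃ h ∈ C, ⁅y, h⁆ = y) ∧ ∀ c ∈ C, ∃ r : ℚ, ⁅y, c⁆ = r • y)
    (hLY : L = Submodule.span ℚ (C ∪ Y)) {d : ℕ} (hd : C ^ (d + 1) ≤ (1 ⊔ L) ^ d) (r : ℕ) :
    ∀ s, r + s = d + 1 → L ^ r * C ^ s ≤ (1 ⊔ L) ^ d := by
  induction r with
  | zero => intro s hs; obtain rfl : s = d + 1 := by omega
            simpa using hd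
  | succ r ih =>
    intro s hs
    have key : ∀ u ∈ L ^ r, ∀ y ∈ L, ∀ c ∈ C ^ s, u * y * c ∈ (1 ⊔ L) ^ d := by
      intro u hu y hy c hc
      rw [hLY] at hy
      refine Submodule.span_induction (p := fun y _ => u * y * c ∈ (1 ⊔ L) ^ d)
        ?_ (by simp) ?_ ?_ hy
      · rintro y (hy | hy)
        · rw [mul_assoc]
          refine ih (s + 1) (by omega) (Submodule.mul_mem_mul hu ?_)
          rw [pow_succ']
          exact Submodule.mul_mem_mul hy hc
        · obtain ⟨⟨h, hh, hyh⟩, hyC⟩ := hY y hy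
          have hyL : y ∈ L := hLY ▸ Submodule.subset_span (Or.inr hy)
          obtain ⟨z, hz, hz'⟩ := exists_lie_sub_mem hL hCL hC hyL hh hyh hyC hc 0
          rw [add_zero] at hz hz'
          have hd' : d = r + s := by omega
          have h1 : u * z ∈ (1 ⊔ L) ^ d := ih (s + 1) (by omega) (Submodule.mul_mem_mul hu hz)
          have h2 := lie_pow_mem (lie_one_sup_mem hL hyL) d _ h1
          have h3 : ⁅y, u⁆ * z ∈ (1 ⊔ L) ^ d := ih (s + 1) (by omega)
            (Submodule.mul_mem_mul (lie_pow_mem (hL y hyL) r u hu) hz)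
          have h4 : u * (⁅y, z⁆ - y * (h ^ 0 * c)) ∈ (1 ⊔ L) ^ d := by
            rw [hd', pow_add]
            exact Submodule.mul_mem_mul (pow_le_one_sup_pow le_rfl r hu) hz'
          -- The first two terms reduce to `r` factors from `L` and `s + 1` from `C`, since `⁅y, ·⁆`
          -- preserves the powers of `L` and of `1 ⊔ L`. The third has degree `r + s = d`.
          have : u * y * c = ⁅y, u * z⁆ - ⁅y, u⁆ * z - u * (⁅y, z⁆ - y * (h ^ 0 * c)) := by
            simp only [Ring.lie_def]; noncomm_ring
          rw [this]
          exact sub_mem (sub_mem h2 h3) h4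
      · intro y z _ _ hy hz; rw [mul_add, add_mul]; exact add_mem hy hz
      · intro a y _ hy; rw [mul_smul_comm, smul_mul_assoc]; exact Submodule.smul_mem _ _ hy
    rw [pow_succ, Submodule.mul_le]
    intro v hv c hc
    refine Submodule.mul_induction_on (C := fun v => v * c ∈ (1 ⊔ L) ^ d) hv
      (fun u hu y hy => key u hu y hy c hc) fun v w hv hw => ?_
    rw [add_mul]; exact add_mem hv hw

lemma one_sup_pow_succ_le (L : Submodule ℚ A) (k : ℕ) :
    (1 ⊔ L) ^ (k + 1) ≤ (1 ⊔ L) ^ k ⊔ L ^ (k + 1) := by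
  induction k with
  | zero => simp
  | succ k ih =>
    rw [pow_succ _ (k + 1), Submodule.mul_sup, mul_one]
    refine sup_le le_sup_left ((mul_le_mul_left ih _).trans ?_)
    rw [Submodule.sup_mul, ← pow_succ]
    refine sup_le_sup_right ?_ _
    rw [pow_succ]
    exact mul_le_mul_right le_sup_right _

/-- Once `L ^ (d + 1)` falls into `(1 ⊔ L) ^ d`, the filtration is stationary from `d` on, and its
union is the algebra generated by `L`. -/
lemma one_sup_pow_eq_top_of_weights (hL : ∀ x ∈ L, ∀ y ∈ L, ⁅x, y⁆ ∈ L) (hCL : C ≤ L)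
    (hC : ∀ x ∈ C, ∀ y ∈ C, x * y = y * x) {Y : Set A}
    (hY : ∀ y ∈ Y, (∃ h ∈ C, ⁅y, h⁆ = y) ∧ ∀ c ∈ C, ∃ r : ℚ, ⁅y, c⁆ = r • y)
    (hLY : L = Submodule.span ℚ (C ∪ Y)) {d : ℕ} (hd : C ^ (d + 1) ≤ (1 ⊔ L) ^ d)
    (hgen : Algebra.adjoin ℚ (L : Set A) = ⊤) : (1 ⊔ L) ^ d = ⊤ := by
  have h1 : L ^ (d + 1) ≤ (1 ⊔ L) ^ d := by
    simpa using pow_mul_pow_le_of_weights hL hCL hC hY hLY hd (d + 1) 0 rfl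
  have h2 : (1 ⊔ L) ^ (d + 1) ≤ (1 ⊔ L) ^ d :=
    (one_sup_pow_succ_le L d).trans (sup_le le_rfl h1)
  have h3 : ∀ k, (1 ⊔ L) ^ (d + k) ≤ (1 ⊔ L) ^ d := by
    intro k
    induction k with
    | zero => exact le_rfl
    | succ k ih =>
      rw [← add_assoc, pow_succ]
      refine (mul_le_mul_left ih _).trans ?_
      rwa [← pow_succ]
  have h4 : ∀ k, (1 ⊔ L) ^ k ≤ (1 ⊔ L) ^ d := fun k =>
    (one_sup_pow_mono (Nat.le_add_left k d)).trans (h3 k)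
  rw [eq_top_iff]
  intro x _
  have hx : x ∈ Algebra.adjoin ℚ (L : Set A) := hgen ▸ Algebra.mem_top
  induction hx using Algebra.adjoin_induction with
  | mem x hx => exact h4 1 (by rw [pow_one]; exact Submodule.mem_sup_right hx)
  | algebraMap r => exact h4 0 (by rw [pow_zero]; exact Submodule.mem_one.2 ⟨r, rfl⟩)
  | add x y _ _ hx hy => exact add_mem (hx trivial) (hy trivial)
  | mul x y _ _ hx hy =>
    refine h4 (d + d) ?_
    rw [pow_add]; exact Submodule.mul_mem_mul (hx trivial) (hy trivial)

end Filtration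

/-! ### Spanning by sorted products -/

section Sorted

variable {A : Type*} [Ring A] [Algebra ℚ A] {ι : Type*} [LinearOrder ι] (b : ι → A)

/-- The span of the products of `m` factors `b i` in weakly increasing order. -/
def sortedSpan (m : ℕ) : Submodule ℚ A :=
  Submodule.span ℚ {x | ∃ l : List ι, l.Pairwise (· ≤ ·) ∧ l.length = m ∧ (l.map b).prod = x}

variable {b}

lemma sortedSpan_le_succ {i₀ : ι} (h : b i₀ = 1) (m : ℕ) : sortedSpan b m ≤ sortedSpan b (m + 1) := by
  refine Submodule.span_le.2 ?_
  rintro x ⟨l, hl, hm, rfl⟩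
  -- Inserting the letter `i₀`, whose value is `1`, lengthens the list without changing the product.
  refine Submodule.subset_span ⟨l.orderedInsert (· ≤ ·) i₀, hl.orderedInsert i₀ l, ?_, ?_⟩
  · rw [List.orderedInsert_length, hm]
  · clear hl hm
    induction l with
    | nil => simp [h]
    | cons a l ih =>
      rw [List.orderedInsert_cons]
      split_ifs
      · simp [h]
      · simp [ih]

omit [LinearOrder ι] in
lemma map_prod_mem_span_pow (l : List ι) :
    (l.map b).prod ∈ Submodule.span ℚ (Set.range b) ^ l.length := by
  induction l with
  | nil => exact Submodule.mem_one.2 ⟨1, by simp⟩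
  | cons a l ih =>
    rw [List.map_cons, List.prod_cons, List.length_cons, pow_succ']
    exact Submodule.mul_mem_mul (Submodule.subset_span ⟨a, rfl⟩) ih

omit [LinearOrder ι] in
lemma prod_sub_prod_mem_of_perm
    (hb : ∀ i j, ⁅b i, b j⁆ ∈ Submodule.span ℚ (Set.range b)) {l l' : List ι} (hl : l.Perm l') :
    (l.map b).prod - (l'.map b).prod ∈ lowerPow (Submodule.span ℚ (Set.range b)) l.length := by
  induction hl with
  | nil => simp
  | cons a _ ih =>
    rw [List.map_cons, List.map_cons, List.prod_cons, List.prod_cons, ← mul_sub, List.length_cons,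
      add_comm]
    refine pow_mul_lowerPow_le _ 1 _ (Submodule.mul_mem_mul ?_ ih)
    rw [pow_one]
    exact Submodule.subset_span ⟨a, rfl⟩
  | swap i j l =>
    simp only [List.map_cons, List.prod_cons, List.length_cons, ← mul_assoc, ← sub_mul]
    rw [lowerPow, pow_succ']
    exact Submodule.mul_mem_mul (hb j i) (map_prod_mem_span_pow l)
  | trans h1 _ ih1 ih2 =>
    rw [← h1.length_eq] at ih2
    simpa using add_mem ih1 ih2

/-- The spanning half of the Poincaré–Birkhoff–Witt argument: sorting a product changes it by terms
of lower degree, which are sorted by induction and padded with `1`. -/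
lemma span_pow_le_sortedSpan {i₀ : ι} (h : b i₀ = 1)
    (hb : ∀ i j, ⁅b i, b j⁆ ∈ Submodule.span ℚ (Set.range b)) (m : ℕ) :
    Submodule.span ℚ (Set.range b) ^ m ≤ sortedSpan b m := by
  induction m with
  | zero =>
    rw [pow_zero, Submodule.one_eq_span, Submodule.span_le]
    rintro x rfl
    exact Submodule.subset_span ⟨[], by simp, rfl, rfl⟩
  | succ m ih =>
    rw [Submodule.span_pow, Submodule.span_le]
    intro x hx
    obtain ⟨g, rfl⟩ := Set.mem_pow.1 hx
    choose k hk using fun i => (g i).2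
    have e1 : (List.ofFn fun i => (g i : A)) = (List.ofFn k).map b := by
      rw [List.map_ofFn]; congr 1; ext i; exact (hk i).symm
    set l := List.ofFn k with hl
    have hlen : l.length = m + 1 := by simp [hl]
    have hp : l.Perm (l.mergeSort (· ≤ ·)) := (List.mergeSort_perm _ _).symm
    have h1 := prod_sub_prod_mem_of_perm hb hp
    rw [hlen] at h1
    have h2 : ((l.mergeSort (· ≤ ·)).map b).prod ∈ sortedSpan b (m + 1) :=
      Submodule.subset_span ⟨_, List.pairwise_mergeSort' _ _, by simp [hlen], rfl⟩
    rw [SetLike.mem_coe, e1]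
    have := add_mem (sortedSpan_le_succ h m (ih h1)) h2
    simpa using this

lemma sortedSpan_le_span_range_sym (b : ι → A) (m : ℕ) :
    sortedSpan b m ≤ Submodule.span ℚ (Set.range fun s : Sym ι m => ((s.1.sort).map b).prod) := by
  refine Submodule.span_mono ?_
  rintro x ⟨l, hl, hm, rfl⟩
  refine ⟨⟨(l : Multiset ι), by simp [hm]⟩, ?_⟩
  simp only [Multiset.coe_sort]
  rw [List.mergeSort_eq_self _ hl]

lemma finite_and_finrank_le_card_sym [Fintype ι] {i₀ : ι} (h : b i₀ = 1)
    (hb : ∀ i j, ⁅b i, b j⁆ ∈ Submodule.span ℚ (Set.range b)) {m : ℕ}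
    (htop : Submodule.span ℚ (Set.range b) ^ m = ⊤) :
    Module.Finite ℚ A ∧ Module.finrank ℚ A ≤ Nat.card (Sym ι m) := by
  have h1 : Submodule.span ℚ (Set.range fun s : Sym ι m => ((s.1.sort).map b).prod) = ⊤ :=
    top_le_iff.1 (htop ▸ (span_pow_le_sortedSpan h hb m).trans (sortedSpan_le_span_range_sym b m))
  refine ⟨⟨?_⟩, ?_⟩
  · rw [← h1]; exact Submodule.fg_span (Set.finite_range _)
  · rw [← finrank_top, ← h1, Nat.card_eq_fintype_card]
    exact finrank_range_le_card _

end Sorted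

/-! ### Integral weights of commuting elements -/

section Weights

variable {B : Type*} [CommRing B] [Algebra ℚ B] {κ : Type*} [DecidableEq κ] (h : κ → B)

/-- The product of the falling factorials of the `h k`, each of degree the multiplicity of `k`
in the list. -/
def descList : List κ → B
  | [] => 1
  | k :: l => (h k - (l.count k : B)) * descList l

variable {h}

omit [Algebra ℚ B] in
lemma prod_range_dvd_descList (k : κ) (l : List κ) :
    ∏ m ∈ Finset.range (l.count k), (h k - (m : B)) ∣ descList h l := by
  induction l with
  | nil => simp
  | cons a l ih =>
    rw [descList]
    by_cases ha : a = k
    · subst ha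
      rw [List.count_cons_self, Finset.prod_range_succ, mul_comm]
      exact mul_dvd_mul_left _ ih
    · rw [List.count_cons_of_ne ha]
      exact Dvd.dvd.mul_left ih _

/-- If the `h k` are roots of `∏_{m ≤ d} (t - m)` and sum up to `d`, then products of falling
factorials of total degree `d + 1` vanish. -/
lemma descList_eq_zero [Fintype κ] {d : ℕ} (hsum : ∑ k, h k = (d : B))
    (hprod : ∀ k, ∏ m ∈ Finset.range (d + 1), (h k - (m : B)) = 0) {l : List κ}
    (hl : l.length = d + 1) : descList h l = 0 := by
  -- A nonzero element has a proper annihilator, contained in some maximal ideal `M`. Modulo `M` the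
  -- `h k` become natural numbers, a joint eigenvalue in a field of characteristic zero.
  by_contra hne
  have hI : Ideal.torsionOf B B (descList h l) ≠ ⊤ := by
    rwa [Ne, Ideal.torsionOf_eq_top_iff]
  obtain ⟨M, hM, hIM⟩ := Ideal.exists_le_maximal _ hI
  let _ : Field (B ⧸ M) := Ideal.Quotient.field M
  have : CharZero (B ⧸ M) := algebraRat.charZero _
  have key : ∀ k, ∃ m : ℕ, l.count k ≤ m ∧ Ideal.Quotient.mk M (h k) = (m : B ⧸ M) := by
    intro k
    have hle : l.count k ≤ d + 1 := hl ▸ List.count_le_length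
    -- `descList h l` already contains the factors `h k - m` with `m < l.count k`, so the remaining
    -- ones annihilate it. One of these therefore vanishes modulo `M`, forcing `l.count k ≤ m k`.
    have h1 : ∏ m ∈ Finset.Ico (l.count k) (d + 1), (h k - (m : B)) ∈ M := by
      apply hIM
      rw [Ideal.mem_torsionOf_iff, smul_eq_mul]
      obtain ⟨q, hq⟩ := prod_range_dvd_descList (h := h) k l
      rw [hq, ← mul_assoc, mul_comm (∏ m ∈ Finset.Ico _ _, _), Finset.prod_range_mul_prod_Ico _ hle,
        hprod, zero_mul]
    rw [← Ideal.Quotient.eq_zero_iff_mem, map_prod, Finset.prod_eq_zero_iff] at h1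
    obtain ⟨m, hm, hm'⟩ := h1
    refine ⟨m, (Finset.mem_Ico.1 hm).1, ?_⟩
    simpa [sub_eq_zero] using hm'
  choose m hm hm' using key
  have h2 : ((∑ k, m k : ℕ) : B ⧸ M) = (d : B ⧸ M) := by
    push_cast
    rw [← map_natCast (Ideal.Quotient.mk M) d, ← hsum, map_sum]
    exact Finset.sum_congr rfl fun k _ => (hm' k).symm
  have h3 : ∑ k, m k = d := by exact_mod_cast h2
  have h4 : ∑ k, l.count k = d + 1 := by
    rw [← hl]
    simpa using Multiset.sum_count_eq_card (s := Finset.univ) (m := (l : Multiset κ)) (by simp)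
  -- The counts sum to `d + 1`, yet are bounded termwise by the `m k`, which sum to `d`.
  have := Finset.sum_le_sum fun k (_ : k ∈ Finset.univ) => hm k
  omega

lemma descList_sub_mem (S : Submodule ℚ B) (h1 : 1 ∈ S) (hS : ∀ k, h k ∈ S) (l : List κ) :
    descList h l ∈ S ^ l.length ∧ (l.map h).prod ∈ S ^ l.length ∧
      descList h l - (l.map h).prod ∈ lowerPow S l.length := by
  induction l with
  | nil => exact ⟨Submodule.mem_one.2 ⟨1, by simp [descList]⟩, Submodule.mem_one.2 ⟨1, by simp⟩,
      by simp [descList]⟩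
  | cons k l ih =>
    obtain ⟨ih1, ih2, ih3⟩ := ih
    have hn : (l.count k : B) ∈ S := by
      rw [← nsmul_one]; exact nsmul_mem h1 _
    rw [List.length_cons, List.map_cons, List.prod_cons, descList]
    refine ⟨?_, ?_, ?_⟩
    · rw [pow_succ']; exact Submodule.mul_mem_mul (sub_mem (hS k) hn) ih1
    · rw [pow_succ']; exact Submodule.mul_mem_mul (hS k) ih2
    · have : (h k - (l.count k : B)) * descList h l - h k * (l.map h).prod =
          h k * (descList h l - (l.map h).prod) - (l.count k : ℚ) • descList h l := by
        rw [Algebra.smul_def, map_natCast]; ring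
      rw [this]
      refine sub_mem ?_ (Submodule.smul_mem _ _ ih1)
      rw [add_comm]
      refine pow_mul_lowerPow_le _ 1 _ (Submodule.mul_mem_mul ?_ ih3)
      rw [pow_one]; exact hS k

/-- A monomial of degree `d + 1` is the leading term of its `descList`, which vanishes. -/
lemma span_pow_succ_le_of_weights [Fintype κ] {d : ℕ} (hsum : ∑ k, h k = (d : B))
    (hprod : ∀ k, ∏ m ∈ Finset.range (d + 1), (h k - (m : B)) = 0) :
    Submodule.span ℚ (Set.range h) ^ (d + 1) ≤ (1 ⊔ Submodule.span ℚ (Set.range h)) ^ d := by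
  rw [Submodule.span_pow, Submodule.span_le]
  intro x hx
  obtain ⟨g, rfl⟩ := Set.mem_pow.1 hx
  choose k hk using fun i => (g i).2
  have e1 : (List.ofFn fun i => (g i : B)) = (List.ofFn k).map h := by
    rw [List.map_ofFn]; congr 1; ext i; exact (hk i).symm
  have hlen : (List.ofFn k).length = d + 1 := by simp
  have := (descList_sub_mem (1 ⊔ Submodule.span ℚ (Set.range h))
    (Submodule.mem_sup_left (Submodule.mem_one.2 ⟨1, map_one _⟩))
    (fun k => Submodule.mem_sup_right (Submodule.subset_span ⟨k, rfl⟩)) (List.ofFn k)).2.2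
  rw [descList_eq_zero hsum hprod hlen, hlen, zero_sub, neg_mem_iff] at this
  rw [SetLike.mem_coe, e1]
  exact this

end Weights

/-- The argument by maximal ideals needs a commutative ring, so it is run in the subalgebra
generated by the `H k`. -/
lemma span_pow_succ_le_of_commute {A : Type*} [Ring A] [Algebra ℚ A] {n d : ℕ} {H : Fin n → A}
    (hcomm : ∀ i j, H i * H j = H j * H i) (hsum : ∑ k, H k = (d : A))
    (hprod : ∀ k, ((List.range (d + 1)).map (fun m : ℕ => H k - (m : A))).prod = 0) :
    Submodule.span ℚ (Set.range H) ^ (d + 1) ≤ (1 ⊔ Submodule.span ℚ (Set.range H)) ^ d := by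
  have hmc : IsMulCommutative (Algebra.adjoin ℚ (Set.range H)) :=
    Algebra.isMulCommutative_adjoin ℚ (by rintro _ ⟨i, rfl⟩ _ ⟨j, rfl⟩; exact hcomm i j)
  let _ : CommRing (Algebra.adjoin ℚ (Set.range H)) :=
    { (inferInstance : Ring (Algebra.adjoin ℚ (Set.range H))) with mul_comm := hmc.is_comm.comm }
  let B := Algebra.adjoin ℚ (Set.range H)
  let h : Fin n → B := fun k => ⟨H k, Algebra.subset_adjoin ⟨k, rfl⟩⟩
  have hspan : (Submodule.span ℚ (Set.range h)).map B.val.toLinearMap =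
      Submodule.span ℚ (Set.range H) := by
    rw [Submodule.map_span, ← Set.range_comp]; rfl
  have h1 := span_pow_succ_le_of_weights (h := h) (d := d) (by
      apply Subtype.ext; simpa [h] using hsum) (by
      intro k
      apply Subtype.ext
      have : ∀ N, ((∏ m ∈ Finset.range N, (h k - (m : B)) : B) : A) =
          ((List.range N).map (fun m : ℕ => H k - (m : A))).prod := by
        intro N
        induction N with
        | zero => simp
        | succ N ih => rw [Finset.prod_range_succ, List.prod_range_succ, ← ih]; simp [h]
      rw [this, hprod]; rfl)
  have h2 := Submodule.map_mono (f := B.val.toLinearMap) h1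
  rw [Submodule.map_pow, Submodule.map_pow, Submodule.map_sup, Submodule.map_one, hspan] at h2
  exact h2

/-! ### The presented algebra has dimension at most that of the Schur algebra -/

section Presented

variable {n d : ℕ}

lemma gen_rel {x y : Free n} (h : SchurRel n d x y) :
    RingQuot.mkAlgHom ℚ (SchurRel n d) x = RingQuot.mkAlgHom ℚ (SchurRel n d) y :=
  RingQuot.mkAlgHom_rel ℚ h

lemma map_two_free : RingQuot.mkAlgHom ℚ (SchurRel n d) (2 : Free n) = 2 := map_ofNat _ 2

variable (n d) in
/-- The elements `e_i` of the presented algebra, extended by zero to all `i`. -/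
noncomputable def genE (i : ℕ) : PresentedAlgebra n d :=
  if h : i < n - 1 then gen n d (Gen.e ⟨i, h⟩) else 0

variable (n d) in
/-- The elements `f_i` of the presented algebra, extended by zero to all `i`. -/
noncomputable def genF (i : ℕ) : PresentedAlgebra n d :=
  if h : i < n - 1 then gen n d (Gen.f ⟨i, h⟩) else 0

variable (n d) in
/-- The elements `H_i` of the presented algebra, extended by zero to all `i`. -/
noncomputable def genH (i : ℕ) : PresentedAlgebra n d :=
  if h : i < n then gen n d (Gen.H ⟨i, h⟩) else 0

lemma genE_of_lt {i : ℕ} (h : i < n - 1) : genE n d i = gen n d (Gen.e ⟨i, h⟩) := dif_pos h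
lemma genF_of_lt {i : ℕ} (h : i < n - 1) : genF n d i = gen n d (Gen.f ⟨i, h⟩) := dif_pos h
lemma genH_of_lt {i : ℕ} (h : i < n) : genH n d i = gen n d (Gen.H ⟨i, h⟩) := dif_pos h
lemma genE_of_ge {i : ℕ} (h : n - 1 ≤ i) : genE n d i = 0 := dif_neg (by omega)
lemma genF_of_ge {i : ℕ} (h : n - 1 ≤ i) : genF n d i = 0 := dif_neg (by omega)
lemma genH_of_ge {i : ℕ} (h : n ≤ i) : genH n d i = 0 := dif_neg (by omega)

lemma dotProduct_ε_α (i : Fin n) (j : Fin (n - 1)) :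
    ((ε i ⬝ᵥ α j : ℤ) : ℚ) = wt i j (j + 1) := by
  simp only [ε, α, wt, single_one_dotProduct, Pi.sub_apply, Pi.single_apply, Fin.ext_iff, fst, snd]
  push_cast
  rfl

lemma lie_lie_eq {R : Type*} [Ring R] (x y : R) :
    ⁅x, ⁅x, y⁆⁆ = x ^ 2 * y - 2 * x * y * x + y * x ^ 2 := by
  simp only [Ring.lie_def]; noncomm_ring

variable (n d) in
lemma isSerre_gen : IsSerre (n - 1) (genE n d) (genF n d) (genH n d) where
  HH i j := by
    by_cases hi : i < n
    · by_cases hj : j < n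
      · rw [genH_of_lt hi, genH_of_lt hj, Ring.lie_def, sub_eq_zero]
        simpa using! gen_rel (d := d) (.serre (.H_comm ⟨i, hi⟩ ⟨j, hj⟩))
      · rw [genH_of_ge (not_lt.1 hj), lie_zero]
    · rw [genH_of_ge (not_lt.1 hi), zero_lie]
  ef i j hij := by
    by_cases hi : i < n - 1
    · by_cases hj : j < n - 1
      · rw [genE_of_lt hi, genF_of_lt hj, Ring.lie_def]
        have := gen_rel (d := d) (.serre (.e_f ⟨i, hi⟩ ⟨j, hj⟩))
        rw [if_neg (by simpa using hij)] at this
        simpa using! this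
      · rw [genF_of_ge (not_lt.1 hj), lie_zero]
    · rw [genE_of_ge (not_lt.1 hi), zero_lie]
  ef_self i hi := by
    rw [genE_of_lt hi, genF_of_lt hi, genH_of_lt (by omega), genH_of_lt (by omega), Ring.lie_def]
    have := gen_rel (d := d) (.serre (.e_f ⟨i, hi⟩ ⟨i, hi⟩))
    rw [if_pos rfl] at this
    simpa using! this
  He i j := by
    by_cases hj : j < n - 1
    · by_cases hi : i < n
      · rw [genH_of_lt hi, genE_of_lt hj, Ring.lie_def]
        have := gen_rel (d := d) (.serre (.H_e ⟨i, hi⟩ ⟨j, hj⟩))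
        rw [← Int.cast_smul_eq_zsmul ℚ, dotProduct_ε_α] at this
        simpa using! this
      · rw [genH_of_ge (not_lt.1 hi), zero_lie, wt, if_neg (by omega), if_neg (by omega)]
        simp
    · rw [genE_of_ge (not_lt.1 hj), lie_zero, smul_zero]
  Hf i j := by
    by_cases hj : j < n - 1
    · by_cases hi : i < n
      · rw [genH_of_lt hi, genF_of_lt hj, Ring.lie_def]
        have := gen_rel (d := d) (.serre (.H_f ⟨i, hi⟩ ⟨j, hj⟩))
        rw [← Int.cast_smul_eq_zsmul ℚ, dotProduct_ε_α] at this
        simpa using! this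
      · rw [genH_of_ge (not_lt.1 hi), zero_lie, wt, if_neg (by omega), if_neg (by omega)]
        simp
    · rw [genF_of_ge (not_lt.1 hj), lie_zero, smul_zero, neg_zero]
  e_serre i j h := by
    by_cases hi : i < n - 1
    · by_cases hj : j < n - 1
      · rw [genE_of_lt hi, genE_of_lt hj, lie_lie_eq]
        simpa [map_two_free] using! gen_rel (d := d) (.serre (.e_serre ⟨i, hi⟩ ⟨j, hj⟩ h))
      · rw [genE_of_ge (not_lt.1 hj), lie_zero, lie_zero]
    · rw [genE_of_ge (not_lt.1 hi), zero_lie]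
  e_comm i j h := by
    by_cases hi : i < n - 1
    · by_cases hj : j < n - 1
      · rw [genE_of_lt hi, genE_of_lt hj, Ring.lie_def]
        simpa using! gen_rel (d := d) (.serre (.e_comm ⟨i, hi⟩ ⟨j, hj⟩ h))
      · rw [genE_of_ge (not_lt.1 hj), lie_zero]
    · rw [genE_of_ge (not_lt.1 hi), zero_lie]
  f_serre i j h := by
    by_cases hi : i < n - 1
    · by_cases hj : j < n - 1
      · rw [genF_of_lt hi, genF_of_lt hj, lie_lie_eq]
        simpa [map_two_free] using! gen_rel (d := d) (.serre (.f_serre ⟨i, hi⟩ ⟨j, hj⟩ h))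
      · rw [genF_of_ge (not_lt.1 hj), lie_zero, lie_zero]
    · rw [genF_of_ge (not_lt.1 hi), zero_lie]
  f_comm i j h := by
    by_cases hi : i < n - 1
    · by_cases hj : j < n - 1
      · rw [genF_of_lt hi, genF_of_lt hj, Ring.lie_def]
        simpa using! gen_rel (d := d) (.serre (.f_comm ⟨i, hi⟩ ⟨j, hj⟩ h))
      · rw [genF_of_ge (not_lt.1 hj), lie_zero]
    · rw [genF_of_ge (not_lt.1 hi), zero_lie]
  e_zero i h := genE_of_ge h
  f_zero i h := genF_of_ge h

lemma sum_gen_H : ∑ k : Fin n, gen n d (Gen.H k) = (d : PresentedAlgebra n d) := by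
  simpa using! gen_rel (SchurRel.H_sum (n := n) (d := d))

/-- The sides differ in where the cast sits: on the left `m` has type `R` and the list of naturals
is coerced to a list in `R`, as in `SchurRel.H_prod`; on the right the cast is inside the function.
-/
lemma map_range_prod_eq {R : Type} [Ring R] (N : ℕ) (x : R) :
    ((List.range N).map (fun m => x - (m : R))).prod =
      ((List.range N).map (fun m : ℕ => x - (m : R))).prod := by
  congr 1
  simp [List.map_eq_flatMap, List.flatMap_assoc]

lemma prod_gen_H (k : Fin n) :
    ((List.range (d + 1)).map
      (fun m : ℕ => gen n d (Gen.H k) - (m : PresentedAlgebra n d))).prod = 0 := by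
  have := gen_rel (SchurRel.H_prod (n := n) (d := d) k)
  rw [map_range_prod_eq, map_list_prod, List.map_map, map_zero] at this
  rw [← this]
  congr 2
  ext m
  simp [gen, Free.H]

lemma adjoin_range_gen : Algebra.adjoin ℚ (Set.range (gen n d)) = ⊤ := by
  have h1 : Set.range (gen n d) =
      RingQuot.mkAlgHom ℚ (SchurRel n d) '' Set.range (FreeAlgebra.ι ℚ) := by
    rw [← Set.range_comp]; rfl
  rw [h1, ← AlgHom.map_adjoin, FreeAlgebra.adjoin_range_ι, Algebra.map_top]
  exact (AlgHom.range_eq_top _).2 (RingQuot.mkAlgHom_surjective ℚ _)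

/-! ### The degree bound in the presented algebra. -/

variable (n d) in
/-- The span of the root vectors and the `H_i` in the presented algebra. -/
noncomputable def genSpan : Submodule ℚ (PresentedAlgebra n d) :=
  rootSpan (genE n d) (genF n d) (genH n d)

lemma lie_mem_genSpan : ∀ x ∈ genSpan n d, ∀ y ∈ genSpan n d, ⁅x, y⁆ ∈ genSpan n d :=
  fun _ hx _ hy => (isSerre_gen n d).lie_mem hx hy

lemma gen_mem_genSpan (g : Gen n) : gen n d g ∈ genSpan n d := by
  rcases g with i | i | i
  · rw [← genE_of_lt i.2]; exact rootVec_mem _ _ _ i 0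
  · rw [← genF_of_lt i.2]; exact rootVec_mem' _ _ _ i 0
  · rw [← genH_of_lt i.2]; exact H_mem _ _ _ i

variable (n d) in
/-- The span of the `H_i` in the presented algebra. -/
noncomputable def cartanSpan : Submodule ℚ (PresentedAlgebra n d) :=
  Submodule.span ℚ (Set.range fun k : Fin n => gen n d (Gen.H k))

lemma genH_mem_cartanSpan (i : ℕ) : genH n d i ∈ cartanSpan n d := by
  by_cases hi : i < n
  · rw [genH_of_lt hi]; exact Submodule.subset_span ⟨_, rfl⟩
  · rw [genH_of_ge (not_lt.1 hi)]; exact zero_mem _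

lemma cartanSpan_le : cartanSpan n d ≤ genSpan n d := by
  refine Submodule.span_le.2 ?_
  rintro _ ⟨k, rfl⟩
  exact gen_mem_genSpan _

lemma gen_H_comm (i j : Fin n) :
    gen n d (Gen.H i) * gen n d (Gen.H j) = gen n d (Gen.H j) * gen n d (Gen.H i) := by
  have := (isSerre_gen n d).HH i j
  rwa [genH_of_lt i.2, genH_of_lt j.2, Ring.lie_def, sub_eq_zero] at this

lemma cartanSpan_comm : ∀ x ∈ cartanSpan n d, ∀ y ∈ cartanSpan n d, x * y = y * x := by
  intro x hx y hy
  refine Submodule.span_induction₂ (p := fun x y _ _ => x * y = y * x) ?_ ?_ ?_ ?_ ?_ ?_ ?_ hx hy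
  · rintro _ _ ⟨i, rfl⟩ ⟨j, rfl⟩; exact gen_H_comm i j
  · simp
  · simp
  · intro x y z _ _ _ h1 h2; rw [add_mul, mul_add, h1, h2]
  · intro x y z _ _ _ h1 h2; rw [add_mul, mul_add, h1, h2]
  · intro r x y _ _ h; rw [smul_mul_assoc, mul_smul_comm, h]
  · intro r x y _ _ h; rw [smul_mul_assoc, mul_smul_comm, h]

variable (n d) in
theorem one_sup_genSpan_pow : (1 ⊔ genSpan n d) ^ d = ⊤ := by
  refine one_sup_pow_eq_top_of_weights (C := cartanSpan n d)
    (Y := {x | ∃ i k, x = rootVec (genE n d) i k} ∪ {x | ∃ i k, x = rootVec (genF n d) i k})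
    lie_mem_genSpan cartanSpan_le cartanSpan_comm ?_ ?_ ?_ ?_
  · rintro _ (⟨i, k, rfl⟩ | ⟨i, k, rfl⟩)
    · exact ⟨⟨-genH n d i, neg_mem (genH_mem_cartanSpan i), (isSerre_gen n d).rootVec_lie_neg_H i k⟩,
        exists_lie_eq_smul fun l : Fin n => by
          rw [← genH_of_lt l.2]; exact (isSerre_gen n d).lie_H_rootVec l i k⟩
    · exact ⟨⟨genH n d i, genH_mem_cartanSpan i, (isSerre_gen n d).rootVec_neg_lie_H i k⟩,
        exists_lie_eq_smul fun l : Fin n => by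
          rw [← genH_of_lt l.2]; exact (isSerre_gen n d).lie_H_rootVec_neg l i k⟩
  · apply le_antisymm
    · refine Submodule.span_le.2 ?_
      rintro x (hx | ⟨i, rfl⟩)
      · exact Submodule.subset_span (Or.inr hx)
      · exact Submodule.subset_span (Or.inl (genH_mem_cartanSpan i))
    · refine Submodule.span_le.2 ?_
      rintro x (hx | hx)
      · exact cartanSpan_le hx
      · exact Submodule.subset_span (Or.inl hx)
  · refine (span_pow_succ_le_of_commute gen_H_comm sum_gen_H prod_gen_H).trans ?_
    exact pow_le_pow_left' (sup_le_sup_left cartanSpan_le 1) d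
  · rw [eq_top_iff, ← adjoin_range_gen]
    refine Algebra.adjoin_mono ?_
    rintro _ ⟨g, rfl⟩
    exact gen_mem_genSpan g

/-! ### A spanning family with `n ^ 2` members, and the dimension bound. -/

variable (n d) in
/-- A family spanning the span of `1`, the root vectors and the `H_i`, with `1` in place of the
first `H_i`. -/
noncomputable def rootFamily (p : Fin n ×ₗ Fin n) : PresentedAlgebra n d :=
  if (ofLex p).1 < (ofLex p).2 then
    rootVec (genE n d) (ofLex p).1 ((ofLex p).2 - (ofLex p).1 - 1)
  else if (ofLex p).2 < (ofLex p).1 then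
    rootVec (genF n d) (ofLex p).2 ((ofLex p).1 - (ofLex p).2 - 1)
  else if ((ofLex p).1 : ℕ) = 0 then 1 else genH n d (ofLex p).1

lemma rootVec_eq_zero {L : Type*} [LieRing L] {e : ℕ → L} {m : ℕ} (he : ∀ i, m ≤ i → e i = 0)
    {i k : ℕ} (h : m ≤ i + k) : rootVec e i k = 0 := by
  rcases k with _ | k
  · exact he i h
  · rw [rootVec, he _ (by omega), lie_zero]

lemma span_range_rootFamily (hn : 0 < n) :
    Submodule.span ℚ (Set.range (rootFamily n d)) = 1 ⊔ genSpan n d := by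
  have hone : (1 : PresentedAlgebra n d) ∈ Submodule.span ℚ (Set.range (rootFamily n d)) :=
    Submodule.subset_span ⟨toLex (⟨0, hn⟩, ⟨0, hn⟩), by simp [rootFamily]⟩
  have hpos : ∀ k : Fin n, (k : ℕ) ≠ 0 →
      gen n d (Gen.H k) ∈ Submodule.span ℚ (Set.range (rootFamily n d)) := fun k hk =>
    Submodule.subset_span ⟨toLex (k, k), by simp [rootFamily, hk, genH_of_lt]⟩
  apply le_antisymm
  · refine Submodule.span_le.2 ?_
    rintro _ ⟨p, rfl⟩
    rw [rootFamily]
    split_ifs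
    · exact Submodule.mem_sup_right (rootVec_mem _ _ _ _ _)
    · exact Submodule.mem_sup_right (rootVec_mem' _ _ _ _ _)
    · exact Submodule.mem_sup_left (Submodule.mem_one.2 ⟨1, map_one _⟩)
    · exact Submodule.mem_sup_right (H_mem _ _ _ _)
  · refine sup_le ?_ (Submodule.span_le.2 ?_)
    · rw [Submodule.one_eq_span, Submodule.span_le]
      rintro _ rfl
      exact hone
    · rintro _ ((⟨i, k, rfl⟩ | ⟨i, k, rfl⟩) | ⟨i, rfl⟩)
      · by_cases h : i + k < n - 1
        · refine Submodule.subset_span ⟨toLex (⟨i, by omega⟩, ⟨i + k + 1, by omega⟩), ?_⟩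
          rw [rootFamily, if_pos (by simp [Fin.lt_def, add_assoc])]
          congr 1
          simp; omega
        · rw [rootVec_eq_zero (m := n - 1) (fun _ => genE_of_ge) (by omega)]; exact zero_mem _
      · by_cases h : i + k < n - 1
        · refine Submodule.subset_span ⟨toLex (⟨i + k + 1, by omega⟩, ⟨i, by omega⟩), ?_⟩
          rw [rootFamily, if_neg (by simp [Fin.lt_def]; omega),
            if_pos (by simp [Fin.lt_def, add_assoc])]
          congr 1
          simp; omega
        · rw [rootVec_eq_zero (m := n - 1) (fun _ => genF_of_ge) (by omega)]; exact zero_mem _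
      · by_cases hi : i < n
        · rw [genH_of_lt hi]
          rcases Nat.eq_zero_or_pos i with rfl | h0
          -- The first `H` is not in the family; the relation `H_1 + ⋯ + H_n = d` expresses it by
          -- `1` and the others.
          · have h1 := sum_gen_H (n := n) (d := d)
            rw [← Finset.add_sum_erase _ _ (Finset.mem_univ ⟨0, hi⟩)] at h1
            rw [eq_sub_of_add_eq h1, ← nsmul_one]
            refine sub_mem (nsmul_mem hone _) (sum_mem fun k hk => hpos k ?_)
            simpa [Fin.ext_iff] using hk
          · exact hpos _ h0.ne'
        · rw [genH_of_ge (not_lt.1 hi)]; exact zero_mem _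

variable (n d) in
theorem finite_and_finrank_presentedAlgebra_le :
    Module.Finite ℚ (PresentedAlgebra n d) ∧
      Module.finrank ℚ (PresentedAlgebra n d) ≤ Nat.card (Sym (Fin n × Fin n) d) := by
  rcases Nat.eq_zero_or_pos n with rfl | hn
  -- For `n = 0` the family is empty and cannot contain `1`. The algebra is then spanned by `1` if
  -- `d = 0`, and is zero otherwise, since the empty sum equals `d`.
  · rcases Nat.eq_zero_or_pos d with rfl | hd
    · have h1 := one_sup_genSpan_pow 0 0
      rw [pow_zero, Submodule.one_eq_span] at h1
      refine ⟨⟨h1 ▸ Submodule.fg_span (Set.finite_singleton _)⟩, ?_⟩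
      rw [← finrank_top, ← h1]
      refine (finrank_span_le_card _).trans ?_
      simp
    · have h0 : (d : PresentedAlgebra 0 d) = 0 := by rw [← sum_gen_H]; simp
      have h1 : (1 : PresentedAlgebra 0 d) = 0 := by
        have h2 : (algebraMap ℚ (PresentedAlgebra 0 d)) ((d : ℚ)⁻¹ * d) = 0 := by
          rw [map_mul, map_natCast, h0, mul_zero]
        rwa [inv_mul_cancel₀ (by positivity), map_one] at h2
      have := subsingleton_of_zero_eq_one h1.symm
      refine ⟨inferInstance, ?_⟩
      rw [Module.finrank_zero_of_subsingleton]
      exact Nat.zero_le _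
  · refine finite_and_finrank_le_card_sym (ι := Fin n ×ₗ Fin n) (b := rootFamily n d)
      (i₀ := toLex (⟨0, hn⟩, ⟨0, hn⟩)) (by simp [rootFamily]) (fun p q => ?_) ?_
    · have hmem : ∀ p, rootFamily n d p ∈ 1 ⊔ genSpan n d := fun p => by
        rw [← span_range_rootFamily hn]; exact Submodule.subset_span ⟨p, rfl⟩
      rw [span_range_rootFamily hn]
      exact lie_mem_one_sup lie_mem_genSpan (hmem p) (hmem q)
    · rw [span_range_rootFamily hn, one_sup_genSpan_pow]

end Presented

end AssociativeLie

/-! ### The action of `𝔤𝔩ₙ` on tensor space -/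

section TensorAction

variable {n d : ℕ}

/-- The endomorphism of tensor space acting by `X` in place `p`. -/
noncomputable def placeAction (d : ℕ) (p : Fin d) :
    Module.End ℚ (Fin n → ℚ) →ₗ[ℚ] Module.End ℚ (TensorSpace n d) :=
  (PiTensorProduct.mapMultilinear ℚ (fun _ : Fin d => Fin n → ℚ)
    (fun _ : Fin d => Fin n → ℚ)).toLinearMap 1 p

lemma placeAction_apply (p : Fin d) (X : Module.End ℚ (Fin n → ℚ)) :
    placeAction d p X = PiTensorProduct.map (Function.update 1 p X) := rfl

lemma tensorAction_eq_sum (A : Matrix (Fin n) (Fin n) ℚ) :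
    tensorAction n d A = ∑ p, placeAction d p (Matrix.toLin' A) := by
  refine Finset.sum_congr rfl fun p _ => ?_
  rw [placeAction_apply]
  congr 1
  ext1 q
  rw [Function.update_apply]
  rfl

lemma placeAction_mul_map (p : Fin d) (X : Module.End ℚ (Fin n → ℚ))
    (f : Fin d → Module.End ℚ (Fin n → ℚ)) :
    placeAction d p X * PiTensorProduct.map f =
      PiTensorProduct.map (Function.update f p (X * f p)) := by
  rw [placeAction_apply, ← PiTensorProduct.map_mul]
  congr 1
  ext1 q
  by_cases h : q = p
  · subst h; simp
  · simp [h]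

lemma placeAction_mul_self (p : Fin d) (X Y : Module.End ℚ (Fin n → ℚ)) :
    placeAction d p X * placeAction d p Y = placeAction d p (X * Y) := by
  rw [placeAction_apply p Y, placeAction_mul_map, placeAction_apply]
  simp

lemma placeAction_comm {p q : Fin d} (h : p ≠ q) (X Y : Module.End ℚ (Fin n → ℚ)) :
    placeAction d p X * placeAction d q Y = placeAction d q Y * placeAction d p X := by
  rw [placeAction_apply q Y, placeAction_mul_map, ← placeAction_apply, placeAction_apply p X,
    placeAction_mul_map]
  simp [h, h.symm, Function.update_comm h]

variable (n d) in
/-- `tensorAction` as a linear map. -/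
noncomputable def tensorActionHom :
    Matrix (Fin n) (Fin n) ℚ →ₗ[ℚ] Module.End ℚ (TensorSpace n d) :=
  ∑ p, placeAction d p ∘ₗ Matrix.toLin'.toLinearMap

lemma tensorActionHom_apply (A : Matrix (Fin n) (Fin n) ℚ) :
    tensorActionHom n d A = tensorAction n d A := by
  simp [tensorActionHom, tensorAction_eq_sum]

/-- Actions in different places commute, so only the terms with both factors in the same place
contribute to the commutator. -/
lemma tensorActionHom_mul (A B : Matrix (Fin n) (Fin n) ℚ) :
    tensorActionHom n d A * tensorActionHom n d B =
      tensorActionHom n d ⁅A, B⁆ + tensorActionHom n d B * tensorActionHom n d A := by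
  simp only [tensorActionHom_apply, tensorAction_eq_sum, Finset.sum_mul_sum]
  rw [Finset.sum_comm (γ := Fin d) (f := fun p q =>
    placeAction d p (Matrix.toLin' B) * placeAction d q (Matrix.toLin' A)), ← Finset.sum_add_distrib]
  refine Finset.sum_congr rfl fun p _ => ?_
  rw [← Finset.add_sum_erase _ _ (Finset.mem_univ p),
    ← Finset.add_sum_erase _ (fun q => placeAction d q (Matrix.toLin' B) * _) (Finset.mem_univ p),
    ← add_assoc]
  congr 1
  · rw [placeAction_mul_self, placeAction_mul_self, ← map_add, Module.End.mul_eq_comp,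
      Module.End.mul_eq_comp, ← Matrix.toLin'_mul, ← Matrix.toLin'_mul, ← map_add, Ring.lie_def,
      sub_add_cancel]
  · exact Finset.sum_congr rfl fun q hq => placeAction_comm (Finset.ne_of_mem_erase hq).symm _ _

lemma tensorActionHom_one : tensorActionHom n d 1 = (d : Module.End ℚ (TensorSpace n d)) := by
  rw [tensorActionHom_apply, tensorAction_eq_sum, Matrix.toLin'_one]
  have : ∀ p : Fin d, placeAction d p (LinearMap.id : Module.End ℚ (Fin n → ℚ)) = 1 := fun p => by
    rw [placeAction_apply, ← PiTensorProduct.map_one]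
    congr 1
    exact Function.update_eq_self p _
  simp [this]

lemma tensorAction_tprod (A : Matrix (Fin n) (Fin n) ℚ) (v : Fin d → Fin n → ℚ) :
    tensorAction n d A (PiTensorProduct.tprod ℚ v) =
      ∑ p, PiTensorProduct.tprod ℚ (Function.update v p (A.mulVec (v p))) := by
  rw [tensorAction_eq_sum, LinearMap.sum_apply]
  refine Finset.sum_congr rfl fun p _ => ?_
  rw [placeAction_apply, PiTensorProduct.map_tprod]
  congr 1
  ext1 q
  by_cases h : q = p
  · subst h; simp
  · simp [h]

variable (n d) in
/-- The basis of tensor space consisting of the tensors of standard basis vectors. -/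
noncomputable def tensorBasis : Module.Basis (Fin d → Fin n) ℚ (TensorSpace n d) :=
  Basis.piTensorProduct fun _ => Pi.basisFun ℚ (Fin n)

lemma tensorBasis_apply (v : Fin d → Fin n) :
    tensorBasis n d v = PiTensorProduct.tprod ℚ fun p => Pi.single (v p) (1 : ℚ) := by
  simp [tensorBasis, Basis.piTensorProduct_apply]

lemma tensorAction_single_tensorBasis (k : Fin n) (v : Fin d → Fin n) :
    tensorAction n d (Matrix.single k k 1) (tensorBasis n d v) =
      ((Finset.univ.filter fun p => v p = k).card : ℚ) • tensorBasis n d v := by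
  rw [tensorBasis_apply, tensorAction_tprod, Finset.card_filter, Nat.cast_sum, Finset.sum_smul]
  refine Finset.sum_congr rfl fun p _ => ?_
  by_cases h : v p = k
  · rw [if_pos h, Nat.cast_one, one_smul]
    congr 1
    rw [← h, Matrix.mulVec_single_one]
    convert Function.update_eq_self p _ using 2
    ext i
    simp [Matrix.single_apply, Pi.single_apply, eq_comm]
  · rw [if_neg h, Nat.cast_zero, zero_smul]
    refine MultilinearMap.map_coord_zero _ p ?_
    rw [Function.update_self, Matrix.mulVec_single_one]
    ext i
    simp [Ne.symm h]

lemma prod_sub_natCast_apply {M : Type*} [AddCommGroup M] [Module ℚ M] {f : Module.End ℚ M} {v : M}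
    {c : ℚ} (h : f v = c • v) (l : List ℕ) :
    (l.map fun m : ℕ => f - (m : Module.End ℚ M)).prod v =
      (l.map fun m : ℕ => c - (m : ℚ)).prod • v := by
  induction l with
  | nil => simp
  | cons a l ih =>
    rw [List.map_cons, List.prod_cons, Module.End.mul_apply, ih, List.map_cons, List.prod_cons,
      map_smul, LinearMap.sub_apply, h, Module.End.natCast_apply, ← Nat.cast_smul_eq_nsmul ℚ,
      ← sub_smul, smul_smul, mul_comm]

/-- A basis tensor is an eigenvector whose eigenvalue counts the places equal to `k`, a number
between `0` and `d`; so one of the factors kills it. -/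
lemma prod_tensorAction_single (k : Fin n) :
    ((List.range (d + 1)).map (fun m : ℕ => tensorAction n d (Matrix.single k k 1) -
      (m : Module.End ℚ (TensorSpace n d)))).prod = 0 := by
  refine (tensorBasis n d).ext fun v => ?_
  rw [prod_sub_natCast_apply (tensorAction_single_tensorBasis k v), LinearMap.zero_apply,
    List.prod_eq_zero, zero_smul]
  refine List.mem_map.2 ⟨_, List.mem_range.2 (Nat.lt_succ_of_le ?_), sub_self _⟩
  exact (Finset.card_le_univ _).trans_eq (Fintype.card_fin d)

end TensorAction

/-! ### The homomorphism to the Schur algebra -/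

section GenMatrix

attribute [local instance 100] LieRing.ofAssociativeRing

variable {n : ℕ}

lemma lie_single_single (a b c e : Fin n) :
    ⁅Matrix.single a b (1 : ℚ), Matrix.single c e (1 : ℚ)⁆ =
      (if b = c then Matrix.single a e 1 else 0) - (if e = a then Matrix.single c b 1 else 0) := by
  rw [Ring.lie_def]
  congr 1
  · split_ifs with h
    · subst h; simp
    · simp [h]
  · split_ifs with h
    · subst h; simp
    · simp [h]

/-- The matrix units corresponding to the generators. -/
def genMatrix : Gen n → Matrix (Fin n) (Fin n) ℚ
  | .e i => Matrix.single (fst i) (snd i) 1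
  | .f i => Matrix.single (snd i) (fst i) 1
  | .H i => Matrix.single i i 1

lemma genMatrix_serre_e {i j : Fin (n - 1)} (h : Adjacent i j) :
    ⁅genMatrix (Gen.e i), ⁅genMatrix (Gen.e i), genMatrix (Gen.e j)⁆⁆ = 0 := by
  simp only [genMatrix, lie_single_single, lie_sub]
  rcases h with h | h
  · have h1 : snd i = fst j := by simp [fst, snd, h]
    have h2 : snd j ≠ fst i := by simp [fst, snd]; omega
    have h3 : snd i ≠ fst i := by simp [fst, snd]
    rw [if_pos h1, if_neg h2, lie_single_single, lie_zero, if_neg h3, if_neg h2]; simp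
  · have h1 : snd i ≠ fst j := by simp [fst, snd]; omega
    have h2 : snd j = fst i := by simp [fst, snd, h]
    have h3 : snd i ≠ fst i := by simp [fst, snd]
    rw [if_neg h1, if_pos h2, lie_single_single, lie_zero, if_neg h1, if_neg h3]; simp

lemma genMatrix_serre_f {i j : Fin (n - 1)} (h : Adjacent i j) :
    ⁅genMatrix (Gen.f i), ⁅genMatrix (Gen.f i), genMatrix (Gen.f j)⁆⁆ = 0 := by
  simp only [genMatrix, lie_single_single, lie_sub]
  rcases h with h | h
  · have h1 : snd i = fst j := by simp [fst, snd, h]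
    have h2 : fst i ≠ snd j := by simp [fst, snd]; omega
    have h3 : fst i ≠ snd i := by simp [fst, snd]
    rw [if_neg h2, if_pos h1.symm, lie_single_single, lie_zero, if_neg h2, if_neg h3]; simp
  · have h1 : fst j ≠ snd i := by simp [fst, snd]; omega
    have h2 : snd j = fst i := by simp [fst, snd, h]
    have h3 : fst i ≠ snd i := by simp [fst, snd]
    rw [if_pos h2.symm, if_neg h1, lie_single_single, lie_zero, if_neg h3, if_neg h1]; simp

lemma genMatrix_comm_e {i j : Fin (n - 1)} (h : ¬ Adjacent i j) :
    ⁅genMatrix (Gen.e i), genMatrix (Gen.e j)⁆ = 0 := by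
  simp only [Adjacent, not_or] at h
  have h1 : snd i ≠ fst j := by simpa [fst, snd] using h.1
  have h2 : snd j ≠ fst i := by simpa [fst, snd] using h.2
  rw [genMatrix, genMatrix, lie_single_single, if_neg h1, if_neg h2, sub_zero]

lemma genMatrix_comm_f {i j : Fin (n - 1)} (h : ¬ Adjacent i j) :
    ⁅genMatrix (Gen.f i), genMatrix (Gen.f j)⁆ = 0 := by
  simp only [Adjacent, not_or] at h
  have h1 : snd i ≠ fst j := by simpa [fst, snd] using h.1
  have h2 : snd j ≠ fst i := by simpa [fst, snd] using h.2
  rw [genMatrix, genMatrix, lie_single_single, if_neg h2.symm, if_neg h1.symm, sub_zero]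

lemma genMatrix_e_f (i j : Fin (n - 1)) :
    ⁅genMatrix (Gen.e i), genMatrix (Gen.f j)⁆ =
      if i = j then genMatrix (.H (fst j)) - genMatrix (.H (snd j)) else 0 := by
  have h1 : snd i = snd j ↔ i = j := by simp [snd, Fin.ext_iff]
  have h2 : fst j = fst i ↔ i = j := by simp [fst, Fin.ext_iff, eq_comm]
  simp only [genMatrix, lie_single_single, h1, h2]
  split_ifs with h
  · subst h; rfl
  · simp

lemma genMatrix_H_e (i : Fin n) (j : Fin (n - 1)) :
    ⁅genMatrix (.H i), genMatrix (Gen.e j)⁆ = (ε i ⬝ᵥ α j) • genMatrix (Gen.e j) := by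
  simp only [genMatrix, lie_single_single, ε, α, single_one_dotProduct, Pi.sub_apply,
    Pi.single_apply, sub_smul, ite_smul, one_smul, zero_smul]
  congr 1
  · split_ifs with h
    · rw [h]
    · rfl
  · simp only [eq_comm (a := snd j)]
    split_ifs with h
    · rw [h]
    · rfl

lemma genMatrix_H_f (i : Fin n) (j : Fin (n - 1)) :
    ⁅genMatrix (.H i), genMatrix (Gen.f j)⁆ = -((ε i ⬝ᵥ α j) • genMatrix (Gen.f j)) := by
  simp only [genMatrix, lie_single_single, ε, α, single_one_dotProduct, Pi.sub_apply,
    Pi.single_apply, sub_smul, ite_smul, one_smul, zero_smul, neg_sub]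
  congr 1
  · split_ifs with h
    · rw [h]
    · rfl
  · simp only [eq_comm (a := fst j)]
    split_ifs with h
    · rw [h]
    · rfl

lemma genMatrix_H_H (i j : Fin n) : ⁅genMatrix (.H i), genMatrix (.H j)⁆ = 0 := by
  simp only [genMatrix, lie_single_single]
  by_cases h : i = j
  · subst h; simp
  · simp [h, Ne.symm h]

end GenMatrix

section Hom

variable {n d : ℕ}

variable (n d) in
/-- The representation of the free algebra on tensor space. -/
noncomputable def freeHom : Free n →ₐ[ℚ] Module.End ℚ (TensorSpace n d) :=
  FreeAlgebra.lift ℚ fun g => tensorActionHom n d (genMatrix g)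

lemma freeHom_ι (g : Gen n) :
    freeHom n d (FreeAlgebra.ι ℚ g) = tensorActionHom n d (genMatrix g) := by
  rw [freeHom, FreeAlgebra.lift_ι_apply]

lemma tensorActionHom_mul_sub {A B X : Matrix (Fin n) (Fin n) ℚ} (h : ⁅A, B⁆ = X) :
    tensorActionHom n d A * tensorActionHom n d B - tensorActionHom n d B * tensorActionHom n d A =
      tensorActionHom n d X := by
  subst h
  exact sub_eq_of_eq_add (G := Module.End ℚ (TensorSpace n d)) (tensorActionHom_mul A B)

lemma serre_of_mul_eq {R : Type*} [Ring R] {x y z : R} (h1 : x * y = z + y * x)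
    (h2 : x * z = 0 + z * x) : x ^ 2 * y - 2 * x * y * x + y * x ^ 2 = 0 := by
  have h3 : z = x * y - y * x := eq_sub_of_add_eq h1.symm
  rw [zero_add, h3] at h2
  rw [← sub_eq_zero.2 h2]
  noncomm_ring

lemma tensorActionHom_serre {A B : Matrix (Fin n) (Fin n) ℚ} (h : ⁅A, ⁅A, B⁆⁆ = 0) :
    tensorActionHom n d A ^ 2 * tensorActionHom n d B -
      2 * tensorActionHom n d A * tensorActionHom n d B * tensorActionHom n d A +
      tensorActionHom n d B * tensorActionHom n d A ^ 2 = 0 := by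
  refine serre_of_mul_eq (R := Module.End ℚ (TensorSpace n d)) (tensorActionHom_mul A B) ?_
  have := tensorActionHom_mul (d := d) A ⁅A, B⁆
  rwa [h, map_zero] at this

lemma freeHom_rel {x y : Free n} (h : SchurRel n d x y) : freeHom n d x = freeHom n d y := by
  have h2 : freeHom n d 2 = 2 := map_ofNat _ 2
  induction h with
  | serre h =>
    cases h with
    | H_comm i j =>
      rw [map_mul, map_mul, Free.H, Free.H, freeHom_ι, freeHom_ι, ← sub_eq_zero]
      exact (tensorActionHom_mul_sub (genMatrix_H_H i j)).trans (map_zero _)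
    | e_f i j =>
      rw [map_sub, map_mul, map_mul, Free.e, Free.f, freeHom_ι, freeHom_ι]
      refine (tensorActionHom_mul_sub (genMatrix_e_f i j)).trans ?_
      split_ifs
      · rw [map_sub, map_sub, Free.H, Free.H, freeHom_ι, freeHom_ι]
      · rw [map_zero, map_zero]
    | H_e i j =>
      rw [map_sub, map_mul, map_mul, map_zsmul, Free.e, Free.H, freeHom_ι, freeHom_ι]
      exact (tensorActionHom_mul_sub (genMatrix_H_e i j)).trans (map_zsmul _ _ _)
    | H_f i j =>
      rw [map_sub, map_mul, map_mul, map_neg, map_zsmul, Free.f, Free.H, freeHom_ι, freeHom_ι]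
      exact (tensorActionHom_mul_sub (genMatrix_H_f i j)).trans
        ((map_neg _ _).trans (congrArg _ (map_zsmul _ _ _)))
    | e_serre i j h =>
      simp only [map_add, map_sub, map_mul, map_pow, h2, map_zero, Free.e, freeHom_ι]
      exact tensorActionHom_serre (genMatrix_serre_e h)
    | e_comm i j h =>
      rw [map_sub, map_mul, map_mul, map_zero, Free.e, Free.e, freeHom_ι, freeHom_ι]
      exact (tensorActionHom_mul_sub (genMatrix_comm_e h)).trans (map_zero _)
    | f_serre i j h =>
      simp only [map_add, map_sub, map_mul, map_pow, h2, map_zero, Free.f, freeHom_ι]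
      exact tensorActionHom_serre (genMatrix_serre_f h)
    | f_comm i j h =>
      rw [map_sub, map_mul, map_mul, map_zero, Free.f, Free.f, freeHom_ι, freeHom_ι]
      exact (tensorActionHom_mul_sub (genMatrix_comm_f h)).trans (map_zero _)
  | H_sum =>
    rw [map_sum, map_natCast, ← tensorActionHom_one]
    simp only [Free.H, freeHom_ι, ← map_sum, genMatrix]
    congr 1
    ext i j
    simp [Matrix.sum_apply, Matrix.single_apply, Matrix.one_apply, ite_and]
  | H_prod k =>
    rw [map_range_prod_eq, map_list_prod, List.map_map, map_zero]
    have h0 := prod_tensorAction_single (n := n) (d := d) k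
    rw [← h0]
    congr 2
    ext1 m
    rw [Function.comp_apply, map_sub, map_natCast, Free.H, freeHom_ι, tensorActionHom_apply,
      genMatrix]

variable (n d) in
/-- The representation of the presented algebra on tensor space. -/
noncomputable def tensorHom : PresentedAlgebra n d →ₐ[ℚ] Module.End ℚ (TensorSpace n d) :=
  RingQuot.liftAlgHom ℚ ⟨freeHom n d, fun _ _ => freeHom_rel⟩

lemma tensorHom_gen (g : Gen n) : tensorHom n d (gen n d g) = tensorAction n d (genMatrix g) := by
  rw [tensorHom, gen, RingQuot.liftAlgHom_mkAlgHom_apply, freeHom_ι, tensorActionHom_apply]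

end Hom

/-! ### Surjectivity onto the Schur algebra -/

section Surjective

variable {n d : ℕ}

lemma placePerm_tprod (σ : Equiv.Perm (Fin d)) (v : Fin d → Fin n → ℚ) :
    placePerm n d σ (PiTensorProduct.tprod ℚ v) = PiTensorProduct.tprod ℚ (v ∘ σ.symm) :=
  PiTensorProduct.reindex_tprod σ v

lemma placePerm_mul_map (σ : Equiv.Perm (Fin d)) (f : Fin d → Module.End ℚ (Fin n → ℚ)) :
    placePerm n d σ * PiTensorProduct.map f =
      PiTensorProduct.map (f ∘ σ.symm) * placePerm n d σ := by
  refine PiTensorProduct.ext (MultilinearMap.ext fun v => ?_)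
  simp only [LinearMap.compMultilinearMap_apply, Module.End.mul_apply, PiTensorProduct.map_tprod,
    placePerm_tprod]
  rfl

lemma placePerm_mul_symm (σ : Equiv.Perm (Fin d)) :
    placePerm n d σ * placePerm n d σ.symm = 1 := by
  refine PiTensorProduct.ext (MultilinearMap.ext fun v => ?_)
  simp only [LinearMap.compMultilinearMap_apply, Module.End.mul_apply, placePerm_tprod,
    Module.End.one_apply]
  congr 1
  ext1 q
  simp

lemma mem_schurAlgebra_iff {Z : Module.End ℚ (TensorSpace n d)} :
    Z ∈ schurAlgebra n d ↔ ∀ σ, placePerm n d σ * Z = Z * placePerm n d σ := by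
  rw [schurAlgebra, Subalgebra.mem_centralizer_iff, Set.forall_mem_range]

lemma tensorAction_mem_schurAlgebra (A : Matrix (Fin n) (Fin n) ℚ) :
    tensorAction n d A ∈ schurAlgebra n d := by
  refine mem_schurAlgebra_iff.2 fun σ => ?_
  rw [tensorAction_eq_sum, Finset.mul_sum, Finset.sum_mul,
    ← Equiv.sum_comp σ (fun p => placeAction d p _ * placePerm n d σ)]
  refine Finset.sum_congr rfl fun p _ => ?_
  rw [placeAction_apply, placePerm_mul_map, placeAction_apply]
  congr 2
  ext1 q
  simp [Function.update_apply, Equiv.symm_apply_eq]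

/-! ### Generation of the Schur algebra by one-place operators. -/

/-- The sum of all permutations of a pure tensor of endomorphisms. -/
noncomputable def symMap (f : Fin d → Module.End ℚ (Fin n → ℚ)) :
    Module.End ℚ (TensorSpace n d) :=
  ∑ σ : Equiv.Perm (Fin d), PiTensorProduct.map (f ∘ σ)

lemma symMap_comp (f : Fin d → Module.End ℚ (Fin n → ℚ)) (τ : Equiv.Perm (Fin d)) :
    symMap (f ∘ τ) = symMap f := by
  rw [symMap, symMap, ← Equiv.sum_comp (Equiv.mulLeft τ)
    (fun σ : Equiv.Perm (Fin d) => PiTensorProduct.map (f ∘ σ))]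
  rfl

lemma sum_placeAction_mul_symMap (X : Module.End ℚ (Fin n → ℚ))
    (g : Fin d → Module.End ℚ (Fin n → ℚ)) :
    (∑ p, placeAction d p X) * symMap g = ∑ q, symMap (Function.update g q (X * g q)) := by
  simp only [symMap, Finset.sum_mul_sum]
  rw [Finset.sum_comm, Finset.sum_comm (γ := Fin d)]
  refine Finset.sum_congr rfl fun σ _ => ?_
  rw [← Equiv.sum_comp σ (fun q => PiTensorProduct.map (Function.update g q (X * g q) ∘ σ))]
  refine Finset.sum_congr rfl fun p _ => ?_
  rw [placeAction_mul_map]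
  congr 1
  ext1 q
  by_cases h : q = p
  · subst h; simp
  · simp [h]

lemma mem_of_add_mem {R : Type*} [Ring R] [Algebra ℚ R] (B : Subalgebra ℚ R) {x y : R} (hx : x ∈ B)
    (h : x + y ∈ B) : y ∈ B := by
  simpa using sub_mem h hx

/-- Induction on the number of nontrivial tensor factors. Replace one such factor `X` of `f` by `1`
to get `g`, and multiply `symMap g` by `∑ₚ 1 ⊗ ⋯ ⊗ X ⊗ ⋯ ⊗ 1`. Putting `X` in a place where `g` is
`1` gives `symMap f`; putting it elsewhere creates no new nontrivial factor. -/
lemma symMap_mem {B : Subalgebra ℚ (Module.End ℚ (TensorSpace n d))}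
    (hB : ∀ X : Module.End ℚ (Fin n → ℚ), ∑ p, placeAction d p X ∈ B) (m : ℕ) :
    ∀ f : Fin d → Module.End ℚ (Fin n → ℚ), {q | f q ≠ 1}.ncard ≤ m → symMap f ∈ B := by
  induction m with
  | zero =>
    intro f hf
    have hf1 : ∀ q, f q = 1 := by
      rw [Nat.le_zero, Set.ncard_eq_zero] at hf
      simpa [Set.eq_empty_iff_forall_notMem] using hf
    have : ∀ σ : Equiv.Perm (Fin d), PiTensorProduct.map (f ∘ σ) =
        (1 : Module.End ℚ (TensorSpace n d)) := fun σ => by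
      rw [← PiTensorProduct.map_one]
      congr 1
      ext1 q
      exact hf1 _
    rw [symMap]
    exact sum_mem fun σ _ => by rw [this]; exact one_mem B
  | succ m ih =>
    intro f hf
    classical
    by_cases h1 : ∀ q, f q = 1
    · exact ih f (by simp [h1])
    push Not at h1
    obtain ⟨p, hp⟩ := h1
    set g := Function.update f p 1 with hg
    have hsub : {q | g q ≠ 1} ⊆ {q | f q ≠ 1} \ {p} := by
      intro q hq
      by_cases h : q = p
      · subst h; simp [hg] at hq
      · exact ⟨by simpa [hg, h] using hq, h⟩
    have hcard : {q | g q ≠ 1}.ncard ≤ m := by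
      refine (Set.ncard_le_ncard hsub).trans ?_
      have := Set.ncard_sdiff_singleton_add_one (s := {q | f q ≠ 1}) (a := p) hp
      omega
    have h2 := sum_placeAction_mul_symMap (f p) g
    rw [← Finset.sum_filter_add_sum_filter_not Finset.univ (fun q => g q ≠ 1)
      (fun q => symMap (Function.update g q (f p * g q)))] at h2
    have h3 : ∀ q, g q = 1 → symMap (Function.update g q (f p * g q)) = symMap f := by
      intro q hq
      rw [hq, mul_one, ← symMap_comp f (Equiv.swap p q)]
      congr 1
      ext1 r
      rw [Function.comp_apply, Function.update_apply]
      split_ifs with hr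
      · rw [hr, Equiv.swap_apply_right]
      · by_cases hrp : r = p
        · subst hrp
          rw [Equiv.swap_apply_left]
          by_cases hqr : q = r
          · exact absurd hqr.symm hr
          · rw [hg, Function.update_self, ← hq, hg, Function.update_of_ne hqr]
        · rw [Equiv.swap_apply_of_ne_of_ne hrp hr, hg, Function.update_of_ne hrp]
    rw [Finset.sum_congr rfl (s₁ := Finset.univ.filter fun q => ¬ g q ≠ 1)
      (fun q hq => h3 q (by simpa using hq)), Finset.sum_const] at h2
    set k := (Finset.univ.filter fun q => ¬ g q ≠ 1).card with hk
    -- `k` counts the trivial places of `g`, among them `p`, so it can be divided out.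
    have hk0 : k ≠ 0 := Finset.card_ne_zero_of_mem (a := p) (by simp [hg])
    have h4 : ∑ q with g q ≠ 1, symMap (Function.update g q (f p * g q)) ∈ B := by
      refine sum_mem fun q hq => ih _ ((Set.ncard_le_ncard ?_).trans hcard)
      intro r hr
      by_cases h : r = q
      · subst h; simpa using hq
      · simpa [h] using hr
    have h5 : k • symMap f ∈ B := by
      have h6 : (∑ q with g q ≠ 1, symMap (Function.update g q (f p * g q))) + k • symMap f ∈ B :=
        h2 ▸ mul_mem (hB _) (ih g hcard)
      exact mem_of_add_mem (R := Module.End ℚ (TensorSpace n d)) B h4 h6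
    have h7 := B.smul_mem h5 (k : ℚ)⁻¹
    rwa [← Nat.cast_smul_eq_nsmul ℚ, inv_smul_smul₀ (by exact_mod_cast hk0)] at h7

/-- The matrix unit of tensor space attached to two basis tensors. -/
noncomputable def tensorUnit (a b : Fin d → Fin n) : Module.End ℚ (TensorSpace n d) :=
  PiTensorProduct.map fun p => Matrix.toLin' (Matrix.single (a p) (b p) (1 : ℚ))

lemma tensorUnit_tensorBasis (a b c : Fin d → Fin n) :
    tensorUnit a b (tensorBasis n d c) = if b = c then tensorBasis n d a else 0 := by
  rw [tensorUnit, tensorBasis_apply, PiTensorProduct.map_tprod]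
  split_ifs with h
  · subst h
    rw [tensorBasis_apply]
    congr 1
    ext p i
    simp [Matrix.single_apply, Pi.single_apply, eq_comm]
  · obtain ⟨p, hp⟩ := Function.ne_iff.1 h
    refine MultilinearMap.map_coord_zero _ p ?_
    ext i
    simp [hp]

lemma eq_sum_tensorUnit (Z : Module.End ℚ (TensorSpace n d)) :
    Z = ∑ b, ∑ a, (tensorBasis n d).repr (Z (tensorBasis n d b)) a • tensorUnit a b := by
  refine (tensorBasis n d).ext fun c => ?_
  simp only [LinearMap.sum_apply, LinearMap.smul_apply, tensorUnit_tensorBasis]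
  rw [Finset.sum_eq_single c]
  · simp [Module.Basis.sum_repr]
  · intro b _ hb; simp [hb]
  · simp

/-- The Schur algebra is generated by the operators `∑ₚ 1 ⊗ ⋯ ⊗ X ⊗ ⋯ ⊗ 1`. -/
lemma schurAlgebra_le {B : Subalgebra ℚ (Module.End ℚ (TensorSpace n d))}
    (hB : ∀ X : Module.End ℚ (Fin n → ℚ), ∑ p, placeAction d p X ∈ B) : schurAlgebra n d ≤ B := by
  intro Z hZ
  have h1 : ∀ f : Fin d → Module.End ℚ (Fin n → ℚ), ∑ σ : Equiv.Perm (Fin d),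
      placePerm n d σ * PiTensorProduct.map f * placePerm n d σ.symm ∈ B := by
    intro f
    have : ∑ σ : Equiv.Perm (Fin d), placePerm n d σ * PiTensorProduct.map f *
        placePerm n d σ.symm = symMap f := by
      rw [symMap, ← Equiv.sum_comp (Equiv.inv (Equiv.Perm (Fin d)))
        (fun σ => PiTensorProduct.map (f ∘ σ))]
      refine Finset.sum_congr rfl fun σ _ => ?_
      rw [placePerm_mul_map, mul_assoc, placePerm_mul_symm, mul_one]
      rfl
    rw [this]
    exact symMap_mem hB _ f le_rfl
  -- Averaging: the conjugates of `Z` all equal `Z`, while expanding `Z` in the pure tensors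
  -- `tensorUnit a b` turns their sum into a combination of symmetrised pure tensors.
  have h2 : ∑ σ : Equiv.Perm (Fin d), placePerm n d σ * Z * placePerm n d σ.symm ∈ B := by
    rw [eq_sum_tensorUnit Z]
    simp only [Finset.mul_sum, Finset.sum_mul, mul_smul_comm, smul_mul_assoc]
    rw [Finset.sum_comm]
    refine sum_mem fun b _ => ?_
    rw [Finset.sum_comm]
    refine sum_mem fun a _ => ?_
    rw [← Finset.smul_sum]
    exact B.smul_mem (h1 _) _
  have h3 : ∀ σ : Equiv.Perm (Fin d), placePerm n d σ * Z * placePerm n d σ.symm = Z := fun σ => by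
    rw [mem_schurAlgebra_iff.1 hZ, mul_assoc, placePerm_mul_symm, mul_one]
  simp only [h3, Finset.sum_const] at h2
  have h4 := B.smul_mem h2 ((Finset.univ : Finset (Equiv.Perm (Fin d))).card : ℚ)⁻¹
  rwa [← Nat.cast_smul_eq_nsmul ℚ, inv_smul_smul₀] at h4
  simp [Fintype.card_perm, Nat.factorial_ne_zero]

/-! ### The image of the presented algebra. -/

lemma tensorActionHom_genMatrix_mem (g : Gen n) :
    tensorActionHom n d (genMatrix g) ∈ (tensorHom n d).range :=
  ⟨gen n d g, by rw [tensorActionHom_apply]; exact tensorHom_gen g⟩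

lemma tensorActionHom_lie_mem {B : Subalgebra ℚ (Module.End ℚ (TensorSpace n d))}
    {M N X : Matrix (Fin n) (Fin n) ℚ} (hM : tensorActionHom n d M ∈ B)
    (hN : tensorActionHom n d N ∈ B) (h : ⁅M, N⁆ = X) : tensorActionHom n d X ∈ B := by
  rw [← tensorActionHom_mul_sub h]
  exact Subalgebra.sub_mem (A := Module.End ℚ (TensorSpace n d)) B (B.mul_mem hM hN)
    (B.mul_mem hN hM)

/-- Induction on the distance from the diagonal: `E_{i,j} = [E_{i,j-1}, E_{j-1,j}]` for `i < j - 1`,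
and transposed. The case of distance one brackets with a diagonal unit. -/
lemma tensorActionHom_single_mem (k : ℕ) : ∀ i j : Fin n, (j : ℕ) = i + k →
    tensorActionHom n d (Matrix.single i j 1) ∈ (tensorHom n d).range ∧
      tensorActionHom n d (Matrix.single j i 1) ∈ (tensorHom n d).range := by
  induction k with
  | zero =>
    intro i j h
    obtain rfl : j = i := Fin.ext h
    exact ⟨tensorActionHom_genMatrix_mem (.H j), tensorActionHom_genMatrix_mem (.H j)⟩
  | succ k ih =>
    intro i j h
    obtain ⟨h1, h2⟩ := ih i ⟨i + k, by omega⟩ rfl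
    have hm : i + k < n - 1 := by omega
    have hj : j = snd (⟨i + k, hm⟩ : Fin (n - 1)) := Fin.ext h
    have hf : (⟨i + k, by omega⟩ : Fin n) = fst (⟨i + k, hm⟩ : Fin (n - 1)) := rfl
    have hij : j ≠ i := by rintro rfl; omega
    constructor
    · refine tensorActionHom_lie_mem h1 (tensorActionHom_genMatrix_mem (.e ⟨i + k, hm⟩)) ?_
      rw [genMatrix, ← hj, lie_single_single, if_neg hij, if_pos hf, sub_zero]
    · refine tensorActionHom_lie_mem (tensorActionHom_genMatrix_mem (.f ⟨i + k, hm⟩)) h2 ?_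
      rw [genMatrix, ← hj, lie_single_single, if_neg hij.symm, if_pos hf.symm, sub_zero]

lemma tensorActionHom_mem (A : Matrix (Fin n) (Fin n) ℚ) :
    tensorActionHom n d A ∈ (tensorHom n d).range := by
  rw [Matrix.matrix_eq_sum_single A, map_sum]
  refine sum_mem fun i _ => ?_
  rw [map_sum]
  refine sum_mem fun j _ => ?_
  rw [← mul_one (A i j), ← smul_eq_mul, ← Matrix.smul_single, map_smul]
  refine Subalgebra.smul_mem _ ?_ _
  rcases le_total (i : ℕ) j with h | h
  · exact (tensorActionHom_single_mem (j - i) i j (by omega)).1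
  · exact (tensorActionHom_single_mem (i - j) j i (by omega)).2

variable (n d) in
theorem range_tensorHom : (tensorHom n d).range = schurAlgebra n d := by
  apply le_antisymm
  · rw [← Algebra.map_top, ← adjoin_range_gen, AlgHom.map_adjoin, Algebra.adjoin_le_iff]
    rintro _ ⟨_, ⟨g, rfl⟩, rfl⟩
    change tensorHom n d (gen n d g) ∈ schurAlgebra n d
    rw [tensorHom_gen]
    exact tensorAction_mem_schurAlgebra _
  · refine schurAlgebra_le fun X => ?_
    have := tensorActionHom_mem (d := d) (LinearMap.toMatrix' X)
    rwa [tensorActionHom_apply, tensorAction_eq_sum, Matrix.toLin'_toMatrix'] at this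

end Surjective

/-! ### The dimension of the Schur algebra -/

section Dimension

variable {n d : ℕ}

/-- The multiset of the pairs of corresponding entries of two multi-indices. -/
def pairSym (a b : Fin d → Fin n) : Sym (Fin n × Fin n) d :=
  ⟨Finset.univ.val.map fun p => (a p, b p), by simp⟩

lemma pairSym_comp (a b : Fin d → Fin n) (σ : Equiv.Perm (Fin d)) :
    pairSym (a ∘ σ) (b ∘ σ) = pairSym a b := by
  apply Subtype.ext
  change Finset.univ.val.map ((fun p => (a p, b p)) ∘ σ) = _
  rw [← Multiset.map_map, ← Equiv.coe_toEmbedding, ← Finset.map_val, Finset.map_univ_equiv]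
  rfl

lemma exists_pairSym_eq (s : Sym (Fin n × Fin n) d) : ∃ a b : Fin d → Fin n, pairSym a b = s := by
  obtain ⟨s, hs⟩ := s
  induction s using Quotient.inductionOn with
  | h l =>
    obtain rfl : l.length = d := by simpa using hs
    refine ⟨fun p => (l.get p).1, fun p => (l.get p).2, Subtype.ext ?_⟩
    change Finset.univ.val.map l.get = (l : Multiset _)
    rw [Fin.univ_val_map, List.ofFn_get]

variable (n d) in
/-- The endomorphism whose matrix entries depend on the multiset of index pairs only. -/
noncomputable def symEnd :
    (Sym (Fin n × Fin n) d → ℚ) →ₗ[ℚ] Module.End ℚ (TensorSpace n d) where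
  toFun c := (tensorBasis n d).constr ℚ fun b => ∑ a, c (pairSym a b) • tensorBasis n d a
  map_add' c c' := (tensorBasis n d).ext fun b => by
    simp [add_smul, Finset.sum_add_distrib]
  map_smul' r c := (tensorBasis n d).ext fun b => by
    simp [mul_smul, Finset.smul_sum]

lemma symEnd_tensorBasis (c : Sym (Fin n × Fin n) d → ℚ) (b : Fin d → Fin n) :
    symEnd n d c (tensorBasis n d b) = ∑ a, c (pairSym a b) • tensorBasis n d a :=
  (tensorBasis n d).constr_basis ℚ _ b

/-- The value of `c` at the multiset of pairs of `a` and `b` is the matrix entry at `(a, b)`, and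
every multiset arises in this way. -/
lemma symEnd_injective : Function.Injective (symEnd n d) := by
  intro c c' h
  ext s
  obtain ⟨a, b, rfl⟩ := exists_pairSym_eq s
  have := congrArg (fun Z => (tensorBasis n d).repr (Z (tensorBasis n d b)) a) h
  simpa [symEnd_tensorBasis, Finsupp.single_apply] using this

lemma placePerm_tensorBasis (σ : Equiv.Perm (Fin d)) (b : Fin d → Fin n) :
    placePerm n d σ (tensorBasis n d b) = tensorBasis n d (b ∘ σ.symm) := by
  rw [tensorBasis_apply, placePerm_tprod, tensorBasis_apply]
  rfl

lemma symEnd_mem_schurAlgebra (c : Sym (Fin n × Fin n) d → ℚ) :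
    symEnd n d c ∈ schurAlgebra n d := by
  refine mem_schurAlgebra_iff.2 fun σ => (tensorBasis n d).ext fun b => ?_
  rw [Module.End.mul_apply, Module.End.mul_apply, placePerm_tensorBasis, symEnd_tensorBasis,
    symEnd_tensorBasis, map_sum, 
    ← Equiv.sum_comp (σ.arrowCongr (Equiv.refl (Fin n)))
      (fun a => c (pairSym a (b ∘ σ.symm)) • tensorBasis n d a)]
  refine Finset.sum_congr rfl fun a _ => ?_
  rw [map_smul, placePerm_tensorBasis]
  change _ = c (pairSym (a ∘ σ.symm) (b ∘ σ.symm)) • tensorBasis n d (a ∘ σ.symm)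
  rw [pairSym_comp]

instance : Module.Finite ℚ (TensorSpace n d) := Module.Finite.of_basis (tensorBasis n d)

instance : Module.Finite ℚ (schurAlgebra n d) :=
  inferInstanceAs (Module.Finite ℚ (Subalgebra.toSubmodule (schurAlgebra n d)))

variable (n d) in
theorem card_sym_le_finrank_schurAlgebra :
    Nat.card (Sym (Fin n × Fin n) d) ≤ Module.finrank ℚ (schurAlgebra n d) := by
  have h1 : Module.finrank ℚ (Sym (Fin n × Fin n) d → ℚ) = Nat.card (Sym (Fin n × Fin n) d) := by
    rw [Module.finrank_pi, Nat.card_eq_fintype_card]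
  rw [← h1]
  refine LinearMap.finrank_le_finrank_of_injective
    (f := (symEnd n d).codRestrict (Subalgebra.toSubmodule (schurAlgebra n d))
      symEnd_mem_schurAlgebra) ?_
  exact fun c c' h => symEnd_injective (congrArg Subtype.val h)

end Dimension

/-! ### The isomorphism, by comparison of dimensions. -/

variable (n d : ℕ) in
/-- The homomorphism from the presented algebra to the Schur algebra. -/
noncomputable def schurHom : PresentedAlgebra n d →ₐ[ℚ] schurAlgebra n d :=
  (tensorHom n d).codRestrict (schurAlgebra n d) fun x =>
    range_tensorHom n d ▸ AlgHom.mem_range_self (tensorHom n d) x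

lemma injective_of_surjective_of_finrank_eq {V W : Type*} [AddCommGroup V] [Module ℚ V]
    [AddCommMonoid W] [Module ℚ W] [Module.Finite ℚ V] [Module.Finite ℚ W] (f : V →ₗ[ℚ] W)
    (hf : Function.Surjective f) (h : Module.finrank ℚ V = Module.finrank ℚ W) :
    Function.Injective f := by
  let _ : AddCommGroup W := Module.addCommMonoidToAddCommGroup ℚ
  exact (LinearMap.injective_iff_surjective_of_finrank_eq_finrank h).2 hf

variable (n d : ℕ) in
theorem schurHom_bijective : Function.Bijective (schurHom n d) := by
  have hsurj : Function.Surjective (schurHom n d) := by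
    rintro ⟨Z, hZ⟩
    rw [← range_tensorHom] at hZ
    obtain ⟨x, rfl⟩ := hZ
    exact ⟨x, rfl⟩
  obtain ⟨hfin, hle⟩ := finite_and_finrank_presentedAlgebra_le n d
  have h1 : Module.finrank ℚ (schurAlgebra n d) ≤ Module.finrank ℚ (PresentedAlgebra n d) :=
    LinearMap.finrank_le_finrank_of_surjective (f := (schurHom n d).toLinearMap) hsurj
  have h2 : Module.finrank ℚ (PresentedAlgebra n d) = Module.finrank ℚ (schurAlgebra n d) :=
    le_antisymm (hle.trans (card_sym_le_finrank_schurAlgebra n d)) h1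
  refine ⟨?_, hsurj⟩
  exact injective_of_surjective_of_finrank_eq (schurHom n d).toLinearMap hsurj h2

end SchurPres

open SchurPres in
theorem theorem1 (n d : ℕ) :
    ∃ φ : PresentedAlgebra n d ≃ₐ[ℚ] schurAlgebra n d,
      (∀ i : Fin (n - 1),
        (φ (gen n d (Gen.e i)) : Module.End ℚ (TensorSpace n d)) =
          tensorAction n d (Matrix.single (fst i) (snd i) 1)) ∧
      (∀ i : Fin (n - 1),
        (φ (gen n d (Gen.f i)) : Module.End ℚ (TensorSpace n d)) =
          tensorAction n d (Matrix.single (snd i) (fst i) 1)) ∧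
      (∀ k : Fin n,
        (φ (gen n d (Gen.H k)) : Module.End ℚ (TensorSpace n d)) =
          tensorAction n d (Matrix.single k k 1)) :=
  ⟨AlgEquiv.ofBijective (schurHom n d) (schurHom_bijective n d),
    fun i => tensorHom_gen (Gen.e i), fun i => tensorHom_gen (Gen.f i),
    fun k => tensorHom_gen (Gen.H k)⟩
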